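/- **Setting.** Let $\mathfrak g_n$ be one of $A_{n-1}, B_n, C_n, D_n$, realised in $\mathbb Q^n$ with standard basis $\varepsilon_1,\dots,\varepsilon_n$. The positive roots $R^+$ are the $\varepsilon_i-\varepsilon_j$ ($i<j$) and, in addition, the $\varepsilon_i+\varepsilon_j$ ($i<j$) in types $B,C,D$, the $\varepsilon_i$ in type $B$ and the $2\varepsilon_i$ in type $C$. The Weyl group $W$ is $S_n$ in type $A$, the group of all signed permutations in types $B,C$, and the group of signed permutations with an even number of sign changes in type $D$; $(-1)^w$ is the determinant of $w$. Let $\rho$ be the half-sum of the positive roots (in type $A$ normalised to $(n-1,\dots,1,0)$). Let $L(\alpha)=1$ for all $\alpha\in R^+$, except that $L(\alpha)=\tfrac12$ for the short roots of $B_n$. For weights $\lambda,\mu$ put $$\mathrm{KL}^{\mathfrak g_n,L}_{\lambda,\mu}(q)=\sum_{w\in W}(-1)^w\,[e^{w(\lambda+\rho)-(\mu+\rho)}]\prod_{\alpha\in R^+}\frac1{1-q^{L(\alpha)}e^\alpha},$$ where $[e^\beta]$ is the coefficient of $e^\beta$ and each factor is expanded as a geometric series, and let the stable KL polynomial ${}^\infty\mathrm{KL}^{\mathfrak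 g_n,L}_{\lambda,\mu}(q)$ be the same expression with the sum restricted to $w\in S_n\subseteq W$. Let $\mathcal P_m$ be the set of partitions with at most $m$ parts, $|\mu|=\sum_i\mu_i$ and $\|\mu\|=\sum_i(i-1)\mu_i$. For $\diamond\in\{\emptyset,(1),(2),(1,1)\}$ let $\mathcal P_m^\diamond\subseteq\mathcal P_m$ consist, respectively, of the empty partition, of all partitions, of the partitions all of whose rows have even length, and of the partitions all of whose columns have even length. For $\lambda,\mu\in\mathcal P_m$ let $$\overline K^{\diamond}_{\lambda,\mu}(q)=q^{(|\mu|-|\lambda|)/2}\sum_{\nu\in\mathcal P_m}q^{\|\mu\|}K_{\nu,\mu}(q^{-1})\sum_{\gamma\in\mathcal P_m^\diamond}c^\nu_{\lambda\gamma},$$ where $c^\nu_{\lambda\gamma}$ is the Littlewood–Richardson coefficient (the coefficient of the Schur function $s_\nu$ in $s_\lambda s_\gamma$) and $K_{\nu,\mu}(q)=\mathrm{KL}^{A_{m-1},1}_{\nu,\mu}(q)$ is the Kostka–Foulkes polynomial. **Theorem 6.** Let $m\le n$ and $\lambda,\mu\in\mathcal P_m$, extended by zeros to $n$ parts. Let $M$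 be an integer with $M\ge\max(\lambda_1,\mu_1)$ and $M\ge\max(\lambda_1,\mu_1)+\tfrac12(|\mu|-|\lambda|)$, and let $\widehat\lambda=(M-\lambda_n,\dots,M-\lambda_1)$ and $\widehat\mu=(M-\mu_n,\dots,M-\mu_1)$. Then, with $\mathfrak g_n=A_{n-1},B_n,C_n,D_n$ for $\diamond=\emptyset,(1),(2),(1,1)$ respectively, $$\overline K^{\diamond}_{\lambda,\mu}(q)=q^{\|\mu\|+|\mu|-|\lambda|}\,{}^\infty\mathrm{KL}^{\mathfrak g_n,L}_{\widehat\lambda,\widehat\mu}(q^{-1})=q^{\|\mu\|+|\mu|-|\lambda|}\,\mathrm{KL}^{\mathfrak g_n,L}_{\widehat\lambda,\widehat\mu}(q^{-1}).$$ -/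

import Mathlib

namespace StableKL

noncomputable section

/-! ### Polynomials in rational powers of `q` -/

/-- Integer combinations of the powers `q ^ r`, with `r` rational. -/
abbrev QPoly : Type := AddMonoidAlgebra ℤ ℚ

/-- The monomial `q ^ r`. -/
def qPow (r : ℚ) : QPoly := AddMonoidAlgebra.single r 1

/-- The substitution `q ↦ q⁻¹`. -/
def qInv (f : QPoly) : QPoly := AddMonoidAlgebra.mapDomain (fun r : ℚ => -r) f

/-! ### Classical root systems in coordinates -/

/-- The four classical families `A_{n-1}`, `B_n`, `C_n`, `D_n`. -/
inductive ClassicalType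
  | A
  | B
  | C
  | D
  deriving DecidableEq

/-- The standard basis vector `ε_i`. -/
def eps {n : ℕ} (i : Fin n) : Fin n → ℚ := Pi.single i 1

/-- The roots `ε_i - ε_j` with `i < j`. -/
def diffRoots (n : ℕ) : Finset (Fin n → ℚ) :=
  ((Finset.univ : Finset (Fin n × Fin n)).filter fun p => p.1 < p.2).image
    fun p => eps p.1 - eps p.2

/-- The roots `ε_i + ε_j` with `i < j`. -/
def sumRoots (n : ℕ) : Finset (Fin n → ℚ) :=
  ((Finset.univ : Finset (Fin n × Fin n)).filter fun p => p.1 < p.2).image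
    fun p => eps p.1 + eps p.2

/-- The positive roots `R⁺` of `A_{n-1}`, `B_n`, `C_n`, `D_n`. -/
def posRoots (g : ClassicalType) (n : ℕ) : Finset (Fin n → ℚ) :=
  match g with
  | .A => diffRoots n
  | .B => diffRoots n ∪ sumRoots n ∪ Finset.univ.image fun i => eps i
  | .C => diffRoots n ∪ sumRoots n ∪ Finset.univ.image fun i => (2 : ℚ) • eps i
  | .D => diffRoots n ∪ sumRoots n

/-- The vector `ρ`. In type `A` the half sum of the positive roots is normalised so that its last
coordinate is `0`. With `i` counted from `0`, its `i`-th coordinate is `n - 1 - i`,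
`n - 1/2 - i`, `n - i`, `n - 1 - i` in the types `A`, `B`, `C`, `D`. -/
def rho (g : ClassicalType) (n : ℕ) : Fin n → ℚ := fun i =>
  match g with
  | .A => (n : ℚ) - 1 - (i : ℕ)
  | .B => (n : ℚ) - 1 / 2 - (i : ℕ)
  | .C => (n : ℚ) - (i : ℕ)
  | .D => (n : ℚ) - 1 - (i : ℕ)

/-- A signed permutation `w = (s, σ)`, acting by `w ε_j = s (σ j) ε_{σ j}`. -/
abbrev SignedPerm (n : ℕ) : Type := (Fin n → ℤˣ) × Equiv.Perm (Fin n)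

/-- The action of a signed permutation on a vector. -/
def SignedPerm.act {n : ℕ} (w : SignedPerm n) (v : Fin n → ℚ) : Fin n → ℚ :=
  fun i => (((w.1 i : ℤˣ) : ℤ) : ℚ) * v (w.2.symm i)

/-- The sign `(-1)^w`, that is, the determinant of `w`. -/
def SignedPerm.sign {n : ℕ} (w : SignedPerm n) : ℤ :=
  ((Equiv.Perm.sign w.2 * ∏ i, w.1 i : ℤˣ) : ℤ)

/-- The copy of the symmetric group `S_n` formed by the permutations without sign changes. -/
def symGroup (n : ℕ) : Finset (SignedPerm n) := Finset.univ.filter fun w => ∀ i, w.1 i = 1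

/-- The Weyl group: `S_n` in type `A`, all signed permutations in the types `B` and `C`, the
signed permutations with an even number of sign changes in type `D`. -/
def weylGroup (g : ClassicalType) (n : ℕ) : Finset (SignedPerm n) :=
  match g with
  | .A => symGroup n
  | .B => Finset.univ
  | .C => Finset.univ
  | .D => Finset.univ.filter fun w => ∏ i, w.1 i = 1

/-! ### Lusztig `q`-analogues and stable KL polynomials -/

/-- The coefficient of `e^β` in the product of the geometric series
`1 / (1 - q^{L(α)} e^α) = ∑_k q^{k L(α)} e^{k α}` over all positive roots `α`. Only finitely many
families `k` contribute, as the roots are positive. -/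
def kostantCoeff (g : ClassicalType) (n : ℕ) (L : (Fin n → ℚ) → ℚ) (β : Fin n → ℚ) : QPoly :=
  ∑ᶠ k ∈ {k : posRoots g n → ℕ | ∑ α, (k α : ℚ) • (α : Fin n → ℚ) = β},
    qPow (∑ α, (k α : ℚ) * L α)

/-- The Lusztig `q`-analogue `KL_{λ,μ}^{g_n,L}(q)`. -/
def lusztigKL (g : ClassicalType) (n : ℕ) (L : (Fin n → ℚ) → ℚ) (lam mu : Fin n → ℚ) : QPoly :=
  ∑ w ∈ weylGroup g n,
    w.sign • kostantCoeff g n L (w.act (lam + rho g n) - (mu + rho g n))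

/-- The stable KL polynomial `∞KL_{λ,μ}^{g_n,L}(q)`: the sum runs over `S_n` only. -/
def stableKL (g : ClassicalType) (n : ℕ) (L : (Fin n → ℚ) → ℚ) (lam mu : Fin n → ℚ) : QPoly :=
  ∑ w ∈ symGroup n,
    w.sign • kostantCoeff g n L (w.act (lam + rho g n) - (mu + rho g n))

/-- The function `L` on roots: `1`, except for `1/2` on the short roots `± ε_i` (the roots of
squared length `1`) of `B_n`. -/
def rootL (g : ClassicalType) (n : ℕ) (α : Fin n → ℚ) : ℚ :=
  if g = .B ∧ ∑ i, α i ^ 2 = 1 then 1 / 2 else 1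

/-! ### Partitions -/

/-- `𝒫_m`: the partitions with at most `m` parts. -/
abbrev Part (m : ℕ) : Type := {p : Fin m → ℕ // Antitone p}

/-- The size `|p|`. -/
def Part.size {m : ℕ} (p : Part m) : ℕ := ∑ i, p.1 i

/-- `‖p‖ = ∑ (i - 1) p_i` with `i` counted from `1`. -/
def Part.norm {m : ℕ} (p : Part m) : ℕ := ∑ i : Fin m, (i : ℕ) * p.1 i

/-- The part with index `i`, counted from `0`; it is `0` from the index `m` on. -/
def Part.part {m : ℕ} (p : Part m) (i : ℕ) : ℕ := if h : i < m then p.1 ⟨i, h⟩ else 0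

/-- The partition `p` as an integral weight of `g_n`. -/
def Part.weight {m : ℕ} (p : Part m) (n : ℕ) : Fin n → ℚ := fun i => (p.part i : ℚ)

/-- The complemented and reversed partition `(M - p_n, …, M - p_1)`, as a weight of `g_n`. -/
def Part.hat {m : ℕ} (p : Part m) (n M : ℕ) : Fin n → ℚ :=
  fun i => (M : ℚ) - (p.part (Fin.rev i) : ℚ)

/-- The four partitions with at most two cells. -/
inductive Diamond
  | empty
  | cell
  | row
  | column

/-- The type of `g_n` that corresponds to `⋄ = ∅, (1), (2), (1,1)`. -/
def Diamond.type : Diamond → ClassicalType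
  | .empty => .A
  | .cell => .B
  | .row => .C
  | .column => .D

/-- `𝒫_m^⋄`: the partitions with at most `m` parts that can be tiled by `⋄`, that is, the empty
partition, all partitions, those with even rows, those with even columns. The column with index
`j`, counted from `0`, has as many cells as there are parts greater than `j`. -/
def tiled (d : Diamond) (m : ℕ) : Set (Part m) :=
  match d with
  | .empty => {p | ∀ i, p.1 i = 0}
  | .cell => Set.univ
  | .row => {p | ∀ i, Even (p.1 i)}
  | .column => {p | ∀ j : ℕ, Even (Finset.univ.filter fun i => j < p.1 i).card}

/-! ### Littlewood-Richardson coefficients -/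

/-- The alternant `a_{p+δ} = det (x_i ^ (p_j + m - j))`. -/
def alternant {m : ℕ} (p : Fin m → ℕ) : MvPolynomial (Fin m) ℤ :=
  Matrix.det (Matrix.of fun i j : Fin m =>
    (MvPolynomial.X i : MvPolynomial (Fin m) ℤ) ^ (p j + (Fin.rev j : ℕ)))

/-- The Schur polynomial `s_p(x_1, …, x_m) = a_{p+δ} / a_δ`. -/
def schur {m : ℕ} (p : Part m) : FractionRing (MvPolynomial (Fin m) ℤ) :=
  algebraMap _ _ (alternant p.1) / algebraMap _ _ (alternant (0 : Fin m → ℕ))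

open Classical in
/-- The Littlewood-Richardson coefficient `c_{λγ}^ν`: the coefficient of `s_ν` in the expansion of
`s_λ s_γ`. Every partition occurring here has at most `m` parts, so that `m` variables suffice:
the Schur polynomials `s_ν(x_1, …, x_m)`, `ν ∈ 𝒫_m`, form a basis of the symmetric polynomials. -/
def lrCoeff {m : ℕ} (lam gam nu : Part m) : ℤ :=
  if h : ∃ c : Part m →₀ ℤ, schur lam * schur gam = c.sum fun p k => k • schur p
  then h.choose nu else 0

/-! ### `K`-polynomials -/

/-- The Kostka-Foulkes polynomial `K_{λ,μ}(q)`, as the Lusztig `q`-analogue of type `A_{m-1}`. -/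
def kostkaFoulkes {m : ℕ} (lam mu : Part m) : QPoly :=
  lusztigKL .A m (fun _ => 1) (lam.weight m) (mu.weight m)

/-- The cocharge Kostka-Foulkes polynomial `q^{‖μ‖} K_{λ,μ}(q⁻¹)`. -/
def cochargeKostka {m : ℕ} (lam mu : Part m) : QPoly :=
  qPow (mu.norm : ℚ) * qInv (kostkaFoulkes lam mu)

/-- The `K`-polynomial
`q^{(|μ|-|λ|)/2} ∑_{ν ∈ 𝒫_m} (q^{‖μ‖} K_{ν,μ}(q⁻¹)) ∑_{γ ∈ 𝒫_m^⋄} c_{λγ}^ν`. The sums are finite,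
since a term vanishes unless `|ν| = |μ|` and `|γ| = |ν| - |λ|`. -/
def KPoly (d : Diamond) {m : ℕ} (lam mu : Part m) : QPoly :=
  qPow (((mu.size : ℚ) - (lam.size : ℚ)) / 2) *
    ∑ᶠ nu : Part m, (∑ᶠ gam ∈ tiled d m, lrCoeff lam gam nu) • cochargeKostka nu mu

end

end StableKL

/-! Split the positive roots of `d.type` into those of type A and the rest (ε_i + ε_j, and ε_i or
2ε_i). On every remaining root L is half the coordinate sum, while roots of type A have coordinate
sum 0. Hence the remaining roots contribute to the Kostant partition function a power of q that
depends on the weight alone, here q^((|μ|-|λ|)/2) (`rootL_restVec`, `kostantCoeff_eq_finsum`). What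
is left is the type A partition function, weighted by the coefficients of R = ∏ 1/(1 - x^α) over the
remaining roots (`restSeries`).

Complementing in M means negating and reversing weights. This preserves the positive roots of type A
and turns subtraction of the exponents of R into addition, so the alternating sum over S_m pairs the
type A partition function with the coefficients of a_{λ+δ} R (`stableKL_hat_eq_finsum`). That series
is alternating; grouping its exponents into the orbits of the ν + δ gives the sum over ν of
[x^{ν+δ}](a_{λ+δ} R) times K_{ν,μ}(q).

By Littlewood's identities R is the sum of the s_γ over the tiled γ, so the coefficient is the sum
of the c^ν_{λγ} (`finsum_lrCoeff`). For their proof, the series of the tiled partitions is a product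
of geometric series, one for each admissible column length. Its antisymmetrisation is computed in a
field by induction on the number of variables (`sum_sign_chainValue`), each step being Lagrange
interpolation of ∏ (1 - t x_j) at the x_j and at some of 0, 1, -1 (`sum_chain_step_diamond`).

Two comparisons remain. From rank m to rank n, the additional leading coordinates all equal M, and
nonnegativity of the first coordinate of positive roots forces w to fix them (`stableKL_cons`). From
S_n to W, the coordinate sum is nonnegative on positive roots, while for M in the given range a sign
change makes it negative (`lusztigKL_hat_eq_stableKL`). -/

namespace StableKL

/-! ### Symmetrisation of a chain of geometric series -/

/-- The factor `1 - x_i^r` for the roots of `B`, `C`, `D` that involve `ε_i` only. -/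
def diagFactor {R : Type*} [CommRing R] (d : Diamond) (t : R) : R :=
  match d with
  | .cell => 1 - t
  | .row => 1 - t ^ 2
  | _ => 1

/-- The denominator for the columns of length `k` of the partitions tiled by `d`. -/
def chainFactor {R : Type*} [CommRing R] (d : Diamond) (k : ℕ) (t : R) : R :=
  match d with
  | .cell => 1 - t
  | .row => 1 - t ^ 2
  | _ => if Even k then 1 - t else 1

section Field

open Finset Polynomial

variable {K : Type*} [Field K]

/-- Lagrange interpolation at two families of nodes, in top degree. -/
theorem coeff_eq_sum_two_families {n : ℕ} {κ : Type*} [Fintype κ] [DecidableEq κ]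
    {x : Fin n → K} {c : κ → K} (hx : Function.Injective x) (hc : Function.Injective c)
    (hxc : ∀ i k, x i ≠ c k) {Q : K[X]} (hQ : Q.degree < ((n + Fintype.card κ : ℕ) : WithBot ℕ)) :
    Q.coeff (n + Fintype.card κ - 1) =
      ∑ p, Q.eval (x p) / ((∏ j ∈ univ.erase p, (x p - x j)) * ∏ k, (x p - c k)) +
      ∑ k, Q.eval (c k) / ((∏ j, (c k - x j)) * ∏ l ∈ univ.erase k, (c k - c l)) := by
  have hinj : Function.Injective (Sum.elim x c) := hx.sumElim hc hxc
  have hcard : #(univ : Finset (Fin n ⊕ κ)) = n + Fintype.card κ := by simp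
  have h := Lagrange.coeff_eq_sum (s := (univ : Finset (Fin n ⊕ κ))) (v := Sum.elim x c)
    hinj.injOn (P := Q) (by rw [hcard]; exact hQ)
  rw [hcard] at h
  have e1 (p : Fin n) : (univ : Finset (Fin n ⊕ κ)).erase (Sum.inl p) =
      (univ.erase p).disjSum univ := by
    ext (j | j) <;> simp
  have e2 (k : κ) : (univ : Finset (Fin n ⊕ κ)).erase (Sum.inr k) =
      (univ : Finset (Fin n)).disjSum (univ.erase k) := by
    ext (j | j) <;> simp
  rw [h, Fintype.sum_sum_type]
  simp [e1, e2, Finset.prod_disjSum]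

/-- The polynomial `∏ (1 - t x_j)`. -/
noncomputable def reflPoly {n : ℕ} (x : Fin n → K) : K[X] := ∏ j, (1 - X * C (x j))

theorem eval_reflPoly {n : ℕ} (x : Fin n → K) (t : K) :
    (reflPoly x).eval t = ∏ j, (1 - t * x j) := by
  rw [reflPoly, eval_prod]
  exact prod_congr rfl fun j _ => by simp only [eval_sub, eval_one, eval_mul, eval_X, eval_C]

theorem natDegree_reflPoly_le {n : ℕ} (x : Fin n → K) : (reflPoly x).natDegree ≤ n := by
  refine (natDegree_prod_le _ _).trans ?_
  refine (Finset.sum_le_sum (g := fun _ => 1) fun j _ => ?_).trans (by simp)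
  compute_degree

theorem coeff_reflPoly {n : ℕ} (x : Fin n → K) : (reflPoly x).coeff n = (-1) ^ n * ∏ j, x j := by
  have h := coeff_prod_of_natDegree_le (s := (univ : Finset (Fin n)))
    (fun j => (1 - X * C (x j) : K[X])) 1 (fun j _ => by compute_degree)
  have hc (j : Fin n) : (1 - X * C (x j) : K[X]).coeff 1 = -1 * x j := by
    simp [coeff_one]
  simp only [hc, card_univ, Fintype.card_fin, mul_one] at h
  rw [reflPoly, h, prod_mul_distrib]
  simp

theorem degree_reflPoly_lt {n N : ℕ} (x : Fin n → K) (h : n < N) :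
    (reflPoly x).degree < (N : WithBot ℕ) :=
  degree_le_natDegree.trans_lt (by exact_mod_cast (natDegree_reflPoly_le x).trans_lt h)

/-- The product over the pairs `i < j` of `(x_j - x_i) / (1 - x_i x_j)`. -/
noncomputable def pairProd (n : ℕ) (x : Fin n → K) : K :=
  ∏ i, ∏ j ∈ Ioi i, (x j - x i) / (1 - x i * x j)

theorem pairProd_comp {n : ℕ} (x : Fin n → K) (σ : Equiv.Perm (Fin n)) :
    pairProd n (x ∘ σ) = (Equiv.Perm.sign σ : ℤ) * pairProd n x := by
  have := σ.prod_Ioi_comp_eq_sign_mul_prod (f := fun i j => (x j - x i) / (1 - x i * x j))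
    (fun i j => by rw [← neg_div, neg_sub, mul_comm (x i)])
  simpa [pairProd] using this

theorem pairProd_succ {n : ℕ} (x : Fin (n + 1) → K) :
    pairProd (n + 1) x = (∏ j : Fin n, (x j.succ - x 0) / (1 - x 0 * x j.succ)) *
      pairProd n (x ∘ Fin.succ) := by
  rw [pairProd, Fin.prod_univ_succ, pairProd]
  congr 1
  · simp
  · refine prod_congr rfl fun i _ => ?_
    simp

/-- The value of the chain `∏_k (∏_{j > k} x_j) / den (∏_{j ≥ k} x_j)`, defined by recursion. -/
noncomputable def chainValue (den : ℕ → K → K) : (n : ℕ) → (Fin n → K) → K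
  | 0, _ => 1
  | n + 1, x => (∏ j : Fin n, x j.succ) / den (n + 1) (∏ j, x j) * chainValue den n (x ∘ Fin.succ)

/-- The conditions under which `sum_sign_chainValue` makes sense. -/
structure Generic (u : K → K) (den : ℕ → K → K) {n : ℕ} (x : Fin n → K) : Prop where
  inj : Function.Injective x
  ne_zero : ∀ i, x i ≠ 0
  mul_ne_one : ∀ i j, x i * x j ≠ 1
  u_ne_zero : ∀ i, u (x i) ≠ 0
  den_ne_zero : ∀ S : Finset (Fin n), S.Nonempty → den #S (∏ i ∈ S, x i) ≠ 0

theorem Generic.comp {u : K → K} {den : ℕ → K → K} {n m : ℕ} {x : Fin n → K}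
    (h : Generic u den x) {f : Fin m → Fin n} (hf : Function.Injective f) :
    Generic u den (x ∘ f) where
  inj := h.inj.comp hf
  ne_zero i := h.ne_zero _
  mul_ne_one i j := h.mul_ne_one _ _
  u_ne_zero i := h.u_ne_zero _
  den_ne_zero S hS := by
    have := h.den_ne_zero (S.map ⟨f, hf⟩) (hS.map)
    simpa using this

/-- Symmetrising the chain gives a product over pairs, as soon as one step of the recursion is
known. -/
theorem sum_sign_chainValue (u : K → K) (den : ℕ → K → K)
    (hstep : ∀ (n : ℕ) (x : Fin (n + 1) → K), Generic u den x →
      ∑ p, u (x p) * ∏ j ∈ univ.erase p, (x j * (1 - x p * x j) / (x j - x p)) =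
        den (n + 1) (∏ j, x j)) (n : ℕ) (x : Fin n → K) (hx : Generic u den x) :
    ∑ w : Equiv.Perm (Fin n), ((Equiv.Perm.sign w : ℤ) : K) * chainValue den n (x ∘ w) =
      pairProd n x / ∏ i, u (x i) := by
  induction n with
  | zero => simp [chainValue, pairProd]
  | succ n ih =>
    -- Permutations are grouped by the image p of 0: the first factor of the chain omits x_p from
    -- its numerator, its denominator is symmetric, and the rest is a chain in the other n
    -- variables, covered by the induction hypothesis.
    rw [← Equiv.Perm.decomposeFin.symm.sum_comp, Fintype.sum_prod_type]
    have key (p : Fin (n + 1)) : (∑ e : Equiv.Perm (Fin n),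
        ((Equiv.Perm.sign (Equiv.Perm.decomposeFin.symm (p, e)) : ℤ) : K) *
          chainValue den (n + 1) (x ∘ Equiv.Perm.decomposeFin.symm (p, e))) =
        pairProd (n + 1) x / (∏ i, u (x i)) / den (n + 1) (∏ j, x j) *
          (u (x p) * ∏ j ∈ univ.erase p, (x j * (1 - x p * x j) / (x j - x p))) := by
      set s : Equiv.Perm (Fin (n + 1)) := Equiv.swap 0 p with hs
      set y : Fin n → K := x ∘ s ∘ Fin.succ with hy
      have hgy : Generic u den y := hx.comp (s.injective.comp (Fin.succ_injective n))
      have hs0 : s 0 = p := by simp [hs]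
      have hsgn : ((Equiv.Perm.sign s : ℤ) : K) = if p = 0 then 1 else -1 := by
        by_cases hp : p = 0
        · subst hp; simp [hs]
        · simp [hs, Equiv.Perm.sign_swap (Ne.symm hp), hp]
      have hss : ((Equiv.Perm.sign s : ℤ) : K) * ((Equiv.Perm.sign s : ℤ) : K) = 1 := by
        rw [hsgn]; split_ifs <;> simp
      have herase : (univ.erase p : Finset (Fin (n + 1))) =
          univ.map ((Fin.succEmb n).trans s.toEmbedding) := by
        symm
        apply Finset.eq_of_subset_of_card_le
        · intro j
          simp only [mem_erase, mem_univ, and_true, mem_map, true_and,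
            Function.Embedding.trans_apply, Equiv.coe_toEmbedding, Fin.coe_succEmb]
          rintro ⟨i, rfl⟩ h
          rw [← hs0] at h
          exact Fin.succ_ne_zero i (s.injective h)
        · simp
      -- Moving p to the front costs the sign of the swap and splits the pairs containing p off
      -- `pairProd`.
      have hP : (∏ j ∈ univ.erase p, ((x j - x p) / (1 - x p * x j))) * pairProd n y =
          ((Equiv.Perm.sign s : ℤ) : K) * pairProd (n + 1) x := by
        rw [← pairProd_comp, pairProd_succ]
        congr 1
        rw [herase, prod_map]
        simp [hs0]
      have hprod (f : K → K) : f (x p) * ∏ j, f (y j) = ∏ j, f (x j) := by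
        rw [← Equiv.prod_comp s, Fin.prod_univ_succ, hs0]; rfl
      have hprod' (f : K → K) : ∏ j, f (y j) = ∏ j ∈ univ.erase p, f (x j) := by
        rw [herase, prod_map]
        rfl
      have hcv (e : Equiv.Perm (Fin n)) :
          chainValue den (n + 1) (x ∘ Equiv.Perm.decomposeFin.symm (p, e)) =
            (∏ j, y j) / den (n + 1) (∏ j, x j) * chainValue den n (y ∘ e) := by
        rw [chainValue]
        have h1 : (x ∘ Equiv.Perm.decomposeFin.symm (p, e)) ∘ Fin.succ = y ∘ e := by
          funext j
          simp [hy, hs]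
        have h2 : ∏ j, (x ∘ Equiv.Perm.decomposeFin.symm (p, e)) j = ∏ j, x j :=
          Equiv.prod_comp (Equiv.Perm.decomposeFin.symm (p, e)) x
        have h3 : ∏ j : Fin n, (x ∘ Equiv.Perm.decomposeFin.symm (p, e)) j.succ = ∏ j, y j := by
          rw [← Equiv.prod_comp e y]
          exact prod_congr rfl fun j _ => congrFun h1 j
        rw [h1, h2, h3]
      have hsg (e : Equiv.Perm (Fin n)) :
          ((Equiv.Perm.sign (Equiv.Perm.decomposeFin.symm (p, e)) : ℤ) : K) =
            ((Equiv.Perm.sign s : ℤ) : K) * ((Equiv.Perm.sign e : ℤ) : K) := by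
        rw [hsgn, Equiv.Perm.decomposeFin.symm_sign]
        split_ifs <;> simp
      simp_rw [hcv, hsg]
      calc _ = ((Equiv.Perm.sign s : ℤ) : K) * ((∏ j, y j) / den (n + 1) (∏ j, x j)) *
            ∑ e : Equiv.Perm (Fin n), ((Equiv.Perm.sign e : ℤ) : K) *
              chainValue den n (y ∘ e) := by
            rw [mul_sum]; exact sum_congr rfl fun e _ => by ring
        _ = _ := by
          rw [ih y hgy]
          have hd : den (n + 1) (∏ j, x j) ≠ 0 := by
            simpa using hx.den_ne_zero univ univ_nonempty
          have hu := hprod u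
          have hy1 := hprod' id
          simp only [id] at hy1
          have hA : ∏ j ∈ univ.erase p, ((x j - x p) / (1 - x p * x j)) ≠ 0 := by
            refine prod_ne_zero_iff.2 fun j hj => div_ne_zero ?_ ?_
            · exact sub_ne_zero.2 fun h => (mem_erase.1 hj).1 (hx.inj h)
            · exact sub_ne_zero.2 (hx.mul_ne_one p j).symm
          have hB : ∏ j ∈ univ.erase p, (x j * (1 - x p * x j) / (x j - x p)) =
              (∏ j, y j) / ∏ j ∈ univ.erase p, ((x j - x p) / (1 - x p * x j)) := by
            rw [hy1, ← prod_div_distrib]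
            refine prod_congr rfl fun j _ => ?_
            rw [div_div_eq_mul_div]
          have hPy : pairProd n y = ((Equiv.Perm.sign s : ℤ) : K) * pairProd (n + 1) x /
              ∏ j ∈ univ.erase p, ((x j - x p) / (1 - x p * x j)) := by
            rw [← hP, mul_div_cancel_left₀ _ hA]
          have hup := hx.u_ne_zero p
          have huy : ∏ j, u (y j) ≠ 0 := prod_ne_zero_iff.2 fun j _ => hgy.u_ne_zero j
          rw [hB, hPy, ← hu]
          generalize ∏ j ∈ univ.erase p, ((x j - x p) / (1 - x p * x j)) = A at hA
          field_simp
          linear_combination (∏ j, y j) * pairProd (n + 1) x * hss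
    -- By `hstep` the sum over p equals the denominator of the first factor and cancels it.
    rw [sum_congr rfl fun p _ => key p, ← mul_sum, hstep n x hx, div_mul_cancel₀]
    simpa using hx.den_ne_zero univ univ_nonempty

/-- One step of the recursion as an interpolation sum: `u(t) ∏_k (t - c_k) = s t (1 - t ^ 2)`. -/
theorem sum_chain_step {κ : Type*} [Fintype κ] [DecidableEq κ] {c : κ → K}
    (hc : Function.Injective c) {u : K → K} {s : K}
    (hu : ∀ t, u t * ∏ k, (t - c k) = s * (t * (1 - t ^ 2))) (hκ : 0 < Fintype.card κ)
    {n : ℕ} {x : Fin (n + 1) → K} (hinj : Function.Injective x) (hxc : ∀ i k, x i ≠ c k) :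
    ∑ p, u (x p) * ∏ j ∈ univ.erase p, (x j * (1 - x p * x j) / (x j - x p)) =
      s * (-1) ^ n * (∏ j, x j) * ((reflPoly x).coeff (n + Fintype.card κ) -
        ∑ k, (∏ j, (1 - c k * x j)) / ((∏ j, (c k - x j)) * ∏ l ∈ univ.erase k, (c k - c l))) := by
  -- The degree of `reflPoly x` is at most n + 1, which is below the number of nodes because κ is
  -- nonempty.
  have hL := coeff_eq_sum_two_families hinj hc hxc
    (degree_reflPoly_lt x (N := n + 1 + Fintype.card κ) (by omega))
  rw [show n + 1 + Fintype.card κ - 1 = n + Fintype.card κ by omega] at hL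
  simp only [eval_reflPoly] at hL
  rw [hL, add_sub_cancel_right, mul_sum]
  refine sum_congr rfl fun p _ => ?_
  -- The full products contain the factors 1 - x_p² and x_p for j = p. Their product is what `hu`
  -- trades for u(x_p) ∏ (x_p - c_k).
  have e1 : ∏ j, (1 - x p * x j) = (1 - x p * x p) * ∏ j ∈ univ.erase p, (1 - x p * x j) :=
    (mul_prod_erase _ _ (mem_univ p)).symm
  have e2 : ∏ j, x j = x p * ∏ j ∈ univ.erase p, x j := (mul_prod_erase _ _ (mem_univ p)).symm
  have e3 : ∏ j ∈ univ.erase p, (x j - x p) = (-1) ^ n * ∏ j ∈ univ.erase p, (x p - x j) := by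
    have : n = #(univ.erase p) := by simp
    calc _ = ∏ j ∈ univ.erase p, (-1) * (x p - x j) := prod_congr rfl fun j _ => by ring
      _ = _ := by rw [prod_mul_distrib, prod_const, ← this]
  have hc' : ∏ k, (x p - c k) ≠ 0 := prod_ne_zero_iff.2 fun k _ => sub_ne_zero.2 (hxc p k)
  have hd : ∏ j ∈ univ.erase p, (x p - x j) ≠ 0 := prod_ne_zero_iff.2 fun j hj =>
    sub_ne_zero.2 fun h => (mem_erase.1 hj).1 (hinj h.symm)
  have hn : ((-1 : K) ^ n) * (-1) ^ n = 1 := by rw [← mul_pow]; simp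
  rw [prod_div_distrib, prod_mul_distrib, e1, e2, e3]
  field_simp
  have := hu (x p)
  have hn2 : ((-1 : K) ^ n) ^ 2 = 1 := by rw [sq, hn]
  rw [hn2]
  linear_combination (∏ j ∈ univ.erase p, x j) * (∏ j ∈ univ.erase p, (1 - x p * x j)) * this

/-- The extra nodes are the zeros of t (1 - t²) that u lacks: {0} for u = 1 - t², {0, -1} for u = 1
- t, {0, 1, -1} for u = 1 (where s = -1). The node 0 produces the summand 1 of the denominator. The
product of the x_j comes from the top coefficient in the first case and from the nodes ±1 in the
others. -/
theorem sum_chain_step_diamond [CharZero K] {d : Diamond} (hd : d ≠ .empty) {n : ℕ}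
    {x : Fin (n + 1) → K} (hinj : Function.Injective x) (h0 : ∀ i, x i ≠ 0)
    (h1 : ∀ i, x i * x i ≠ 1) :
    ∑ p, diagFactor d (x p) * ∏ j ∈ univ.erase p, (x j * (1 - x p * x j) / (x j - x p)) =
      chainFactor d (n + 1) (∏ j, x j) := by
  have hP : ∏ j, x j ≠ 0 := prod_ne_zero_iff.2 fun j _ => h0 j
  have hx1 (i) : x i ≠ 1 := fun h => h1 i (by rw [h]; simp)
  have hx2 (i) : x i ≠ -1 := fun h => h1 i (by rw [h]; simp)
  have q0 : ∏ j, (-x j) = (-1) ^ (n + 1) * ∏ j, x j := by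
    simp only [prod_neg, card_univ, Fintype.card_fin]
  have q3 : ∏ j, (-1 - x j) = (-1) ^ (n + 1) * ∏ j, (1 + x j) := by
    have := prod_neg (s := (univ : Finset (Fin (n + 1)))) (fun j => 1 + x j)
    rw [card_univ, Fintype.card_fin] at this
    rw [← this]
    exact prod_congr rfl fun j _ => by ring
  have q4 : ∏ j, (1 + x j) ≠ 0 := prod_ne_zero_iff.2 fun j _ h => hx2 j (by linear_combination h)
  have q5 : ∏ j, (1 - x j) ≠ 0 := prod_ne_zero_iff.2 fun j _ h => hx1 j (by linear_combination -h)
  have e2 : (univ : Finset (Fin 2)).erase 0 = {1} := by decide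
  have e2' : (univ : Finset (Fin 2)).erase 1 = {0} := by decide
  have e3 : (univ : Finset (Fin 3)).erase 0 = {1, 2} := by decide
  have e3' : (univ : Finset (Fin 3)).erase 1 = {0, 2} := by decide
  have e3'' : (univ : Finset (Fin 3)).erase 2 = {0, 1} := by decide
  have hcoeff (k : ℕ) (hk : n + 1 < k) : (reflPoly x).coeff k = 0 :=
    coeff_eq_zero_of_natDegree_lt ((natDegree_reflPoly_le x).trans_lt hk)
  cases d with
  | empty => exact absurd rfl hd
  | row =>
    rw [sum_chain_step (c := ![0]) (s := 1) (Function.injective_of_subsingleton _)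
      (fun t => by simp [diagFactor]; ring) (by simp) hinj (fun i k => by simp [h0 i])]
    simp only [Fintype.card_fin, coeff_reflPoly, chainFactor, Fin.sum_univ_one]
    simp [q0]
    rcases neg_one_pow_eq_or K n with h | h <;>
      · rw [pow_succ, h]
        field_simp
        ring
  | cell =>
    rw [sum_chain_step (c := ![0, -1]) (s := 1) (fun i j => by fin_cases i <;> fin_cases j <;> simp)
      (fun t => by simp [diagFactor, Fin.prod_univ_two]; ring) (by simp) hinj
      (fun i k => by fin_cases k <;> simp [h0 i, hx2 i])]
    simp only [Fintype.card_fin, hcoeff (n + 2) (by omega), chainFactor, Fin.sum_univ_two, e2, e2']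
    simp [q0, q3]
    rcases neg_one_pow_eq_or K n with h | h <;>
      · rw [pow_succ, h]
        field_simp
        ring
  | column =>
    have two : (1 : K) + 1 ≠ 0 := by norm_num
    have neg1 : (1 : K) ≠ -1 := by
      intro h; exact two (by linear_combination h)
    rw [sum_chain_step (c := ![0, 1, -1]) (s := -1)
      (fun i j => by
        fin_cases i <;> fin_cases j <;> simp [neg1, neg1.symm])
      (fun t => by simp [diagFactor, Fin.prod_univ_three]; ring) (by simp) hinj
      (fun i k => by fin_cases k <;> simp [h0 i, hx2 i, hx1 i])]
    simp only [Fintype.card_fin, hcoeff (n + 3) (by omega), chainFactor, Fin.sum_univ_three,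
      e3, e3', e3'']
    simp [q0, q3]
    -- The nodes 1 and -1 contribute 1/2 and (-1)^(n+1)/2, which add up or cancel with the parity of
    -- the column length n + 1.
    rcases Nat.even_or_odd n with hn | hn
    · have hn' : ¬ Even (n + 1) := by simpa [Nat.even_add_one] using hn
      simp only [hn', if_false, pow_succ, hn.neg_one_pow]
      field_simp
      ring
    · have hn' : Even (n + 1) := by simpa [Nat.even_add_one] using hn
      simp only [hn', if_true, pow_succ, hn.neg_one_pow]
      field_simp
      ring

/-- The field form of the Littlewood identities. -/
theorem sum_sign_chainValue_diamond [CharZero K] {d : Diamond} (hd : d ≠ .empty) {n : ℕ}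
    {x : Fin n → K} (hx : Generic (diagFactor d) (chainFactor d) x) :
    ∑ w : Equiv.Perm (Fin n), ((Equiv.Perm.sign w : ℤ) : K) *
      chainValue (chainFactor d) n (x ∘ w) = pairProd n x / ∏ i, diagFactor d (x i) :=
  sum_sign_chainValue _ _ (fun _ _ h => sum_chain_step_diamond hd h.inj h.ne_zero
    fun i => h.mul_ne_one i i) n x hx

end Field
end StableKL

namespace StableKL

/-! ### Products of geometric series -/

section Counting

open MvPowerSeries Finset

variable {σ ι : Type*} [Fintype ι]

/-- The families `k` supported on `S` with `∑ k_i α_i = b`. -/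
def solutions (S : Finset ι) (α : ι → σ →₀ ℕ) (b : σ →₀ ℕ) : Set (ι → ℕ) :=
  {k | (∀ i ∉ S, k i = 0) ∧ ∑ i, k i • α i = b}

/-- Every vector in `S` has degree at least 1, so no multiplicity exceeds the degree of `b`. -/
theorem finite_solutions {S : Finset ι} {α : ι → σ →₀ ℕ} (hα : ∀ i ∈ S, α i ≠ 0)
    (b : σ →₀ ℕ) : (solutions S α b).Finite := by
  classical
  refine (Set.finite_Icc (0 : ι → ℕ) (fun _ => b.degree)).subset ?_
  rintro k ⟨hk, rfl⟩
  refine ⟨fun _ => Nat.zero_le _, fun i => ?_⟩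
  by_cases hi : i ∈ S
  · have h1 : 1 ≤ (α i).degree := Nat.one_le_iff_ne_zero.2 fun h =>
      hα i hi ((Finsupp.degree_eq_zero_iff _).1 h)
    have h2 : (∑ i, k i • α i).degree = ∑ i, k i * (α i).degree := by simp
    rw [h2]
    calc k i = k i * 1 := (mul_one _).symm
      _ ≤ k i * (α i).degree := Nat.mul_le_mul_left _ h1
      _ ≤ _ := Finset.single_le_sum (f := fun i => k i * (α i).degree) (fun _ _ => Nat.zero_le _)
          (mem_univ i)
  · simp [hk i hi]

/-- The power series whose coefficients count the families in `solutions S α`. -/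
noncomputable def countOn (S : Finset ι) (α : ι → σ →₀ ℕ) : MvPowerSeries σ ℤ :=
  fun b => ((solutions S α b).ncard : ℤ)

theorem coeff_countOn (S : Finset ι) (α : ι → σ →₀ ℕ) (b : σ →₀ ℕ) :
    coeff b (countOn S α) = ((solutions S α b).ncard : ℤ) := rfl

/-- Either the multiplicity of i is 0, or one copy of α_i can be removed: the recursion of the
geometric series. -/
theorem countOn_insert [DecidableEq ι] {S : Finset ι} {i : ι} (hi : i ∉ S) {α : ι → σ →₀ ℕ}
    (hα : ∀ j ∈ insert i S, α j ≠ 0) :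
    countOn (insert i S) α = countOn S α + monomial (α i) 1 * countOn (insert i S) α := by
  classical
  ext b
  rw [map_add, coeff_monomial_mul, coeff_countOn, coeff_countOn, coeff_countOn, one_mul]
  have hsum (k : ι → ℕ) : ∑ j, (k + Pi.single i 1 : ι → ℕ) j • α j = ∑ j, k j • α j + α i := by
    simp [add_smul, sum_add_distrib, Pi.single_apply, ite_smul]
  have hunion : solutions (insert i S) α b = solutions S α b ∪
      {k ∈ solutions (insert i S) α b | 1 ≤ k i} := by
    ext k
    simp only [solutions, Set.mem_union, Set.mem_ofPred_eq, Finset.mem_insert, not_or]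
    constructor
    · rintro ⟨h1, h2⟩
      by_cases hk : k i = 0
      · exact Or.inl ⟨fun j hj => by
          by_cases hji : j = i
          · rw [hji, hk]
          · exact h1 j ⟨hji, hj⟩, h2⟩
      · exact Or.inr ⟨⟨h1, h2⟩, by omega⟩
    · rintro (⟨h1, h2⟩ | h)
      · exact ⟨fun j hj => h1 j hj.2, h2⟩
      · exact h.1
  have hdisj : Disjoint (solutions S α b) {k ∈ solutions (insert i S) α b | 1 ≤ k i} := by
    rw [Set.disjoint_left]
    rintro k ⟨h1, -⟩ ⟨-, h2⟩
    have := h1 i hi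
    omega
  have hfin := finite_solutions hα b
  have hshift : ({k ∈ solutions (insert i S) α b | 1 ≤ k i}.ncard : ℤ) =
      if α i ≤ b then ((solutions (insert i S) α (b - α i)).ncard : ℤ) else 0 := by
    split_ifs with hb
    · rw [show {k ∈ solutions (insert i S) α b | 1 ≤ k i} =
          (fun k => k + Pi.single i 1) '' solutions (insert i S) α (b - α i) from ?_,
        Set.ncard_image_of_injective _ (add_left_injective _)]
      ext k
      constructor
      · rintro ⟨⟨h1, h2⟩, h3⟩
        have hk : (fun j => if j = i then k i - 1 else k j) + Pi.single i 1 = k := by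
          funext j
          by_cases hj : j = i
          · subst hj; simp; omega
          · simp [hj]
        refine ⟨fun j => if j = i then k i - 1 else k j, ⟨fun j hj => ?_, ?_⟩, hk⟩
        · have : j ≠ i := fun h => hj (by simp [h])
          simp [this, h1 j hj]
        · have h := hsum fun j => if j = i then k i - 1 else k j
          rw [hk, h2] at h
          exact eq_tsub_of_add_eq h.symm
      · rintro ⟨k, ⟨h1, h2⟩, rfl⟩
        refine ⟨⟨fun j hj => ?_, ?_⟩, by simp⟩
        · have : j ≠ i := fun h => hj (by simp [h])
          simp [this, h1 j hj]
        · rw [hsum, h2, tsub_add_cancel_of_le hb]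
    · rw [show {k ∈ solutions (insert i S) α b | 1 ≤ k i} = ∅ from ?_]
      · simp
      rw [Set.eq_empty_iff_forall_notMem]
      rintro k ⟨⟨h1, rfl⟩, h3⟩
      apply hb
      calc α i ≤ k i • α i := by
            conv_lhs => rw [← one_smul ℕ (α i)]
            exact smul_le_smul_of_nonneg_right h3 (zero_le)
        _ ≤ _ := Finset.single_le_sum (f := fun j => k j • α j) (fun _ _ => zero_le) (mem_univ i)
  have hc : (solutions (insert i S) α b).ncard = (solutions S α b).ncard +
      {k ∈ solutions (insert i S) α b | 1 ≤ k i}.ncard := by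
    conv_lhs => rw [hunion]
    exact Set.ncard_union_eq hdisj (hfin.subset (hunion ▸ Set.subset_union_left))
      (hfin.subset fun k hk => hk.1)
  rw [hc, Nat.cast_add, hshift]

theorem countOn_mul_prod {S : Finset ι} {α : ι → σ →₀ ℕ} (hα : ∀ i ∈ S, α i ≠ 0) :
    countOn S α * ∏ i ∈ S, (1 - monomial (α i) 1) = 1 := by
  classical
  induction S using Finset.induction_on with
  | empty =>
    rw [prod_empty, mul_one]
    ext b
    rw [coeff_countOn, coeff_one]
    split_ifs with hb
    · subst hb
      rw [show solutions ∅ α 0 = {0} from ?_]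
      · simp
      ext k
      simp only [solutions, Set.mem_ofPred_eq, Set.mem_singleton_iff]
      exact ⟨fun h => funext fun i => h.1 i (notMem_empty i), by rintro rfl; simp⟩
    · rw [show solutions ∅ α b = ∅ from ?_]
      · simp
      rw [Set.eq_empty_iff_forall_notMem]
      rintro k ⟨h1, rfl⟩
      exact hb (by simp [h1])
  | insert i S hi ih =>
    have := ih fun j hj => hα j (mem_insert_of_mem hj)
    rw [prod_insert hi]
    refine Eq.trans ?_ this
    linear_combination (∏ j ∈ S, (1 - monomial (α j) (1 : ℤ))) * countOn_insert hi hα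

end Counting
end StableKL

namespace StableKL

/-! ### The Littlewood identities -/

section Littlewood

open MvPowerSeries Finset

variable {m : ℕ}

/-- A function on `Fin m` as an exponent. -/
noncomputable def expo (u : Fin m → ℕ) : Fin m →₀ ℕ := Finsupp.equivFunOnFinite.symm u

@[simp]
theorem expo_apply (u : Fin m → ℕ) (i : Fin m) : expo u i = u i := rfl

@[simp]
theorem expo_coe (u : Fin m →₀ ℕ) : expo (u : Fin m → ℕ) = u := by ext; rfl

theorem expo_injective : Function.Injective (expo (m := m)) :=
  Finsupp.equivFunOnFinite.symm.injective

/-- Fixes the convention: renaming sends x_i to x_{w i}, hence exponents are pulled back along `w`.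
-/
theorem coeff_expo_renameEquiv (w : Equiv.Perm (Fin m)) (f : MvPowerSeries (Fin m) ℤ)
    (v : Fin m → ℕ) : coeff (expo v) (renameEquiv ℤ w f) = coeff (expo (v ∘ w)) f := by
  have h := coeff_embDomain_rename w.toEmbedding f (expo (v ∘ w))
  rw [← h]
  have : Finsupp.embDomain w.toEmbedding (expo (v ∘ w)) = expo v := by
    ext i
    obtain ⟨j, rfl⟩ := w.surjective i
    have := Finsupp.embDomain_apply_self w.toEmbedding (expo (v ∘ w)) j
    simpa using this
  rw [this]
  rfl

theorem monomial_expo (v : Fin m → ℕ) :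
    (monomial (expo v) 1 : MvPowerSeries (Fin m) ℤ) = ∏ j, X j ^ v j := by
  rw [monomial_eq', map_one, one_mul, Finsupp.prod_fintype _ _ fun _ => pow_zero _]
  rfl

/-- The pairs that index the positive roots of `g_n` that are not roots of `A_{n-1}`. -/
def restPairs (d : Diamond) (m : ℕ) : Finset (Fin m × Fin m) :=
  match d with
  | .empty => ∅
  | .column => univ.filter fun p => p.1 < p.2
  | _ => univ.filter fun p => p.1 ≤ p.2

/-- The root that belongs to a pair in `restPairs`. -/
noncomputable def restVec (d : Diamond) (p : Fin m × Fin m) : Fin m →₀ ℕ :=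
  match d with
  | .cell => if p.1 = p.2 then Finsupp.single p.1 1 else
      Finsupp.single p.1 1 + Finsupp.single p.2 1
  | _ => Finsupp.single p.1 1 + Finsupp.single p.2 1

theorem restVec_ne_zero (d : Diamond) (p : Fin m × Fin m) : restVec d p ≠ 0 := by
  intro h
  have := DFunLike.congr_fun h p.1
  revert this
  cases d <;> simp only [restVec] <;> try split_ifs
  all_goals simp

/-- The product of the series `1 / (1 - x^α)` over the roots `α` in `restPairs`. -/
noncomputable def restSeries (d : Diamond) (m : ℕ) : MvPowerSeries (Fin m) ℤ :=
  countOn univ fun p : restPairs d m => restVec d p.1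

theorem prod_filter_lt {M : Type*} [CommMonoid M] (f : Fin m → Fin m → M) :
    ∏ p ∈ univ.filter (fun p : Fin m × Fin m => p.1 < p.2), f p.1 p.2 =
      ∏ i, ∏ j ∈ Ioi i, f i j :=
  prod_finset_product _ _ _ (by simp)

theorem prod_filter_le {M : Type*} [CommMonoid M] (f : Fin m → Fin m → M) :
    ∏ p ∈ univ.filter (fun p : Fin m × Fin m => p.1 ≤ p.2), f p.1 p.2 =
      (∏ i, ∏ j ∈ Ioi i, f i j) * ∏ i, f i i := by
  rw [prod_finset_product (f := fun p => f p.1 p.2) _ univ (fun i => Ici i) (by simp),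
    ← prod_mul_distrib]
  refine prod_congr rfl fun i _ => ?_
  rw [← Ioi_insert, prod_insert (by simp), mul_comm]

theorem restSeries_empty : restSeries .empty m = 1 := by
  have := countOn_mul_prod (S := univ) (α := fun p : restPairs .empty m => restVec .empty p.1)
    (fun _ _ => restVec_ne_zero _ _)
  have h : IsEmpty (restPairs .empty m) := ⟨fun p => by have := p.2; simp [restPairs] at this⟩
  simpa [restSeries] using this

theorem restSeries_mul_prod {d : Diamond} (hd : d ≠ .empty) :
    restSeries d m * ((∏ i, ∏ j ∈ Ioi i, (1 - X i * X j)) * ∏ i, diagFactor d (X i)) = 1 := by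
  refine Eq.trans ?_ (countOn_mul_prod (S := univ) (α := fun p : restPairs d m => restVec d p.1)
    (fun _ _ => restVec_ne_zero _ _))
  rw [restSeries]
  congr 1
  symm
  rw [prod_coe_sort (restPairs d m) fun p => 1 - monomial (restVec d p) (1 : ℤ)]
  have hX (i j : Fin m) : monomial (Finsupp.single i 1 + Finsupp.single j 1) (1 : ℤ) =
      X i * X j := by
    rw [X, X, monomial_mul_monomial, one_mul]
  cases d with
  | empty => exact absurd rfl hd
  | column =>
    simp only [restPairs, restVec, diagFactor, prod_const_one, mul_one, hX]
    rw [prod_filter_lt fun i j => 1 - X i * X j]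
  | row =>
    simp only [restPairs, restVec, diagFactor, hX]
    rw [prod_filter_le fun i j => 1 - X i * X j]
    simp only [sq]
  | cell =>
    simp only [restPairs, restVec, diagFactor]
    rw [prod_filter_le fun i j => 1 - monomial (if i = j then Finsupp.single i 1 else
      Finsupp.single i 1 + Finsupp.single j 1) (1 : ℤ)]
    simp only [if_true]
    congr 1
    refine prod_congr rfl fun i _ => prod_congr rfl fun j hj => ?_
    rw [if_neg (mem_Ioi.1 hj).ne, hX]

/-- The positions at which a column of a partition tiled by `d` may end; the column with bottom
row `m - 1 - k` (counted from `0`) has length `m - k`. -/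
def chainIdx (d : Diamond) (m : ℕ) : Finset (Fin m) :=
  match d with
  | .column => univ.filter fun k => Even (m - k)
  | _ => univ

/-- The multiplicity with which columns occur. -/
def chainMult (d : Diamond) : ℕ :=
  match d with
  | .row => 2
  | _ => 1

/-- A column, read from below. -/
noncomputable def chainVec (d : Diamond) (k : Fin m) : Fin m →₀ ℕ :=
  expo fun j => if k ≤ j then chainMult d else 0

theorem chainMult_pos (d : Diamond) : 0 < chainMult d := by
  cases d <;> simp [chainMult]

theorem chainVec_ne_zero (d : Diamond) (k : Fin m) : chainVec d k ≠ 0 := by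
  intro h
  have := DFunLike.congr_fun h k
  simp only [chainVec, expo_apply, le_refl, if_true, Finsupp.coe_zero, Pi.zero_apply] at this
  have h2 := chainMult_pos d
  omega

/-- The series `∑ x^{γ + δ}` over the partitions `γ` tiled by `d`, read from below. -/
noncomputable def chainSeries (d : Diamond) (m : ℕ) : MvPowerSeries (Fin m) ℤ :=
  monomial (expo fun j => (j : ℕ)) 1 * countOn (chainIdx d m) (chainVec d)

theorem chainSeries_mul_prod {d : Diamond} (hd : d ≠ .empty) :
    chainSeries d m * ∏ k : Fin m, chainFactor d (m - k) (∏ j ∈ Ici k, X j) =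
      ∏ j : Fin m, X j ^ (j : ℕ) := by
  have h := countOn_mul_prod (S := chainIdx d m) (α := chainVec d)
    (fun _ _ => chainVec_ne_zero _ _)
  have hv (k : Fin m) : monomial (chainVec d k) (1 : ℤ) =
      (∏ j ∈ Ici k, X j) ^ chainMult d := by
    rw [chainVec, monomial_expo, ← prod_pow, 
      ← prod_filter_mul_prod_filter_not univ (fun j => k ≤ j)]
    rw [prod_congr rfl (g := fun j => X j ^ chainMult d)
        fun j hj => by rw [if_pos (mem_filter.1 hj).2],
      prod_congr (s₁ := univ.filter fun j => ¬ k ≤ j) rfl (g := fun j => 1)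
        fun j hj => by rw [if_neg (mem_filter.1 hj).2, pow_zero], prod_const_one, mul_one]
    congr 1
    ext j; simp
  have e : ∏ k : Fin m, chainFactor d (m - k) (∏ j ∈ Ici k, (X j : MvPowerSeries (Fin m) ℤ)) =
      ∏ k ∈ chainIdx d m, (1 - monomial (chainVec d k) (1 : ℤ)) := by
    simp only [hv]
    cases d with
    | empty => exact absurd rfl hd
    | cell => simp [chainIdx, chainFactor, chainMult]
    | row => simp [chainIdx, chainFactor, chainMult]
    | column => simp [chainIdx, chainFactor, chainMult, prod_filter]
  rw [e, chainSeries, mul_assoc, h, mul_one, monomial_expo]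

/-- The variable x_j occurs in the numerators of exactly the j steps before its own, which accounts
for the exponent δ, read from below. -/
theorem chainValue_mul_prod {K : Type*} [Field K] (den : ℕ → K → K) (n : ℕ) (x : Fin n → K)
    (h : ∀ k : Fin n, den (n - k) (∏ j ∈ Ici k, x j) ≠ 0) :
    chainValue den n x * ∏ k : Fin n, den (n - k) (∏ j ∈ Ici k, x j) = ∏ j, x j ^ (j : ℕ) := by
  induction n with
  | zero => simp [chainValue]
  | succ n ih =>
    have hI (k : Fin n) : ∏ j ∈ Ici k.succ, x j = ∏ j ∈ Ici k, (x ∘ Fin.succ) j := by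
      simp [← Fin.map_succEmb_Ici]
    have h0 := h 0
    have ih' := ih (x ∘ Fin.succ) fun k => by
      have := h k.succ
      rw [hI] at this
      simpa using this
    rw [Fin.prod_univ_succ, Fin.prod_univ_succ, chainValue]
    have hbot : (Ici (0 : Fin (n + 1))) = univ := by ext; simp
    simp only [hI, Fin.val_succ, Nat.add_sub_add_right, Fin.val_zero, Nat.sub_zero, pow_zero,
      one_mul, hbot, pow_succ, prod_mul_distrib] at h0 ⊢
    have ih'' : _ = ∏ j : Fin n, x j.succ ^ (j : ℕ) := ih'
    rw [← ih'']
    field_simp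

theorem map_diagFactor {R S : Type*} [CommRing R] [CommRing S] (f : R →+* S) (d : Diamond)
    (t : R) : f (diagFactor d t) = diagFactor d (f t) := by
  cases d <;> simp [diagFactor]

theorem map_chainFactor {R S : Type*} [CommRing R] [CommRing S] (f : R →+* S) (d : Diamond)
    (k : ℕ) (t : R) : f (chainFactor d k t) = chainFactor d k (f t) := by
  cases d <;> simp [chainFactor, apply_ite f]

theorem diagFactor_zero (d : Diamond) : diagFactor d (0 : ℤ) = 1 := by
  cases d <;> simp [diagFactor]

theorem chainFactor_zero (d : Diamond) (k : ℕ) : chainFactor d k (0 : ℤ) = 1 := by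
  cases d <;> simp [chainFactor]

instance : CharZero (FractionRing (MvPowerSeries (Fin m) ℤ)) :=
  charZero_of_injective_algebraMap (R := ℤ) (by
    rw [IsScalarTower.algebraMap_eq ℤ (MvPowerSeries (Fin m) ℤ)]
    refine (IsFractionRing.injective (MvPowerSeries (Fin m) ℤ) _).comp ?_
    intro a b h
    have := congrArg constantCoeff h
    simpa using this)

/-- The variables in the fraction field of the power series. -/
noncomputable def fracX (i : Fin m) : FractionRing (MvPowerSeries (Fin m) ℤ) :=
  algebraMap (MvPowerSeries (Fin m) ℤ) _ (X i)

/-- All elements that must not vanish, apart from the variables and their differences, have constant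
coefficient 1. -/
theorem generic_fracX (d : Diamond) : Generic (diagFactor d) (chainFactor d) (fracX (m := m)) := by
  set φ := algebraMap (MvPowerSeries (Fin m) ℤ) (FractionRing (MvPowerSeries (Fin m) ℤ))
  have hφ : Function.Injective φ := IsFractionRing.injective _ _
  have hne (a : MvPowerSeries (Fin m) ℤ) (h : constantCoeff a = 1) : φ a ≠ 0 := fun h0 => by
    have : a = 0 := hφ (h0.trans (map_zero φ).symm)
    simp [this] at h
  refine ⟨fun i j h => X_inj.1 (hφ h), fun i h => ?_,
    fun i j h => ?_, fun i => ?_, fun S hS => ?_⟩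
  · have h1 : (X i : MvPowerSeries (Fin m) ℤ) = 0 := hφ (h.trans (map_zero φ).symm)
    have h2 := coeff_index_single_self_X (R := ℤ) i
    simp [h1] at h2
  · refine hne (1 - X i * X j) (by simp) ?_
    rw [map_sub, map_mul, map_one]
    exact sub_eq_zero.2 h.symm
  · have := hne (diagFactor d (X i)) (by rw [map_diagFactor]; simp [diagFactor_zero])
    rwa [map_diagFactor] at this
  · have := hne (chainFactor d #S (∏ i ∈ S, X i)) (by
      rw [map_chainFactor]
      obtain ⟨i, hi⟩ := hS
      rw [map_prod, prod_eq_zero hi (constantCoeff_X i), chainFactor_zero])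
    rw [map_chainFactor, map_prod] at this
    exact this

/-- The Vandermonde product. -/
noncomputable def vand (m : ℕ) : MvPowerSeries (Fin m) ℤ := ∏ i, ∏ j ∈ Ioi i, (X j - X i)

/-- The field identity is applied to the variables themselves in the fraction field; `chainSeries`
and `restSeries` are identified there through the products that clear their denominators. -/
theorem sum_sign_chainSeries {d : Diamond} (hd : d ≠ .empty) :
    ∑ w : Equiv.Perm (Fin m), (Equiv.Perm.sign w : ℤ) • renameEquiv ℤ w (chainSeries d m) =
      vand m * restSeries d m := by
  set φ := algebraMap (MvPowerSeries (Fin m) ℤ) (FractionRing (MvPowerSeries (Fin m) ℤ)) with hφd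
  have hφ : Function.Injective φ := IsFractionRing.injective _ _
  apply hφ
  have hg := generic_fracX (m := m) d
  have hchain (w : Equiv.Perm (Fin m)) : φ (renameEquiv ℤ w (chainSeries d m)) =
      chainValue (chainFactor d) m (fracX ∘ w) := by
    have hden (k : Fin m) : chainFactor d (m - k) (∏ j ∈ Ici k, (fracX ∘ w) j) ≠ 0 := by
      have := (hg.comp w.injective).den_ne_zero (Ici k) ⟨k, by simp⟩
      simpa using this
    have h1 := chainValue_mul_prod (chainFactor d) m (fracX ∘ w) hden
    have h2 := congrArg φ (congrArg (renameEquiv ℤ w) (chainSeries_mul_prod (m := m) hd))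
    have hX (j : Fin m) : renameEquiv ℤ w (X j) = X (w j) := by simp
    have h3 (k : Fin m) : φ (renameEquiv ℤ w (chainFactor d (m - k) (∏ j ∈ Ici k, X j))) =
        chainFactor d (m - k) (∏ j ∈ Ici k, (fracX ∘ w) j) := by
      have := map_chainFactor (φ.comp (renameEquiv ℤ w).toRingEquiv.toRingHom) d (m - k)
        (∏ j ∈ Ici k, X j)
      simp only [map_prod] at this
      simpa [fracX] using this
    rw [map_mul, map_mul, map_prod, map_prod, prod_congr rfl fun k _ => h3 k, map_prod,
      map_prod] at h2
    have h4 : ∏ k : Fin m, chainFactor d (m - k) (∏ j ∈ Ici k, (fracX ∘ w) j) ≠ 0 :=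
      prod_ne_zero_iff.2 fun k _ => hden k
    apply mul_right_cancel₀ h4
    rw [h1, h2]
    simp [fracX, φ]
  rw [map_sum, map_mul]
  simp_rw [map_zsmul, hchain, zsmul_eq_mul]
  rw [sum_sign_chainValue_diamond hd hg]
  have hr := congrArg φ (restSeries_mul_prod (m := m) hd)
  rw [map_mul, map_mul, map_one, map_prod, map_prod] at hr
  simp only [map_prod, map_sub, map_one, map_mul, map_diagFactor] at hr
  have h5 : ∏ i, diagFactor d (fracX (m := m) i) ≠ 0 := prod_ne_zero_iff.2 fun i _ => hg.u_ne_zero i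
  have h6 : ∏ i : Fin m, ∏ j ∈ Ioi i, (1 - fracX (m := m) i * fracX j) ≠ 0 :=
    prod_ne_zero_iff.2 fun i _ => prod_ne_zero_iff.2 fun j _ =>
      sub_ne_zero.2 (hg.mul_ne_one i j).symm
  rw [pairProd, div_eq_iff h5]
  simp only [prod_div_distrib]
  rw [div_eq_iff h6]
  have hv : φ (vand m) = ∏ i : Fin m, ∏ j ∈ Ioi i, (fracX (m := m) j - fracX i) := by
    simp [vand, fracX, map_prod, φ]
  rw [hv]
  change φ _ * ((∏ i : Fin m, ∏ j ∈ Ioi i, (1 - fracX (m := m) i * fracX j)) *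
    ∏ i, diagFactor d (fracX (m := m) i)) = 1 at hr
  linear_combination -(∏ i : Fin m, ∏ j ∈ Ioi i, (fracX (m := m) j - fracX i)) * hr

end Littlewood
end StableKL

namespace StableKL

/-! ### Alternating power series -/

section Alternating

open MvPowerSeries Finset

variable {m : ℕ}

/-- The exponent `p + δ`. -/
def shift (p : Fin m → ℕ) : Fin m → ℕ := fun i => p i + (Fin.rev i : ℕ)

theorem add_le_of_strictAnti {g : Fin m → ℕ} (hg : StrictAnti g) {i j : Fin m} (hij : i ≤ j) :
    g j + (j - i) ≤ g i := by
  obtain ⟨k, hk⟩ := Nat.exists_eq_add_of_le (Fin.le_def.1 hij)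
  induction k generalizing j with
  | zero =>
    have : j = i := Fin.ext (by omega)
    subst this; simp
  | succ k ih =>
    have h1 := ih (j := ⟨i + k, by omega⟩) (by simp [Fin.le_def]) rfl
    have h2 : g j < g ⟨i + k, by omega⟩ := hg (by simp [Fin.lt_def]; omega)
    simp only at h1
    omega

theorem rev_le_of_strictAnti {g : Fin m → ℕ} (hg : StrictAnti g) (i : Fin m) :
    (Fin.rev i : ℕ) ≤ g i := by
  have hi := i.2
  have := add_le_of_strictAnti hg (i := i) (j := ⟨m - 1, by omega⟩)
    (Fin.le_def.2 (Nat.le_sub_one_of_lt i.2))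
  simp only [Fin.val_rev] at this ⊢
  omega

theorem strictAnti_shift (p : Part m) : StrictAnti (shift p.1) := by
  intro i j hij
  have := p.2 hij.le
  simp only [shift, Fin.val_rev]
  have h := Fin.lt_def.1 hij
  omega

theorem shift_injective : Function.Injective (shift (m := m)) := fun p q h => funext fun i => by
  have := congrFun h i
  simpa [shift] using this

/-- Strictly decreasing functions are the shifted partitions. -/
theorem exists_shift_eq {g : Fin m → ℕ} (hg : StrictAnti g) : ∃ p : Part m, shift p.1 = g := by
  refine ⟨⟨fun i => g i - (Fin.rev i : ℕ), fun i j hij => ?_⟩, funext fun i => ?_⟩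
  · have h1 := add_le_of_strictAnti hg hij
    have h2 := rev_le_of_strictAnti hg j
    have := Fin.le_def.1 hij
    simp only [Fin.val_rev] at h2 ⊢
    omega
  · exact Nat.sub_add_cancel (rev_le_of_strictAnti hg i)

/-- Such a permutation is an order automorphism of a finite chain, hence trivial. -/
theorem perm_eq_one_of_strictAnti {g : Fin m → ℕ} (hg : StrictAnti g) {σ : Equiv.Perm (Fin m)}
    (h : StrictAnti (g ∘ σ)) : σ = 1 := by
  have hσ : StrictMono σ := fun i j hij => hg.lt_iff_gt.1 (h hij)
  have := Subsingleton.elim (hσ.orderIsoOfSurjective σ σ.surjective) (OrderIso.refl _)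
  ext i
  exact congrArg Fin.val (DFunLike.congr_fun this i)

/-- Injective exponents are permutations of shifted partitions. -/
theorem exists_shift_comp_eq {u : Fin m → ℕ} (hu : Function.Injective u) :
    ∃ (p : Part m) (σ : Equiv.Perm (Fin m)), u = shift p.1 ∘ σ := by
  have h1 : StrictMono (u ∘ Tuple.sort u) :=
    (Tuple.monotone_sort u).strictMono_of_injective (hu.comp (Tuple.sort u).injective)
  set τ : Equiv.Perm (Fin m) := Fin.revPerm.trans (Tuple.sort u)
  have h2 : StrictAnti (u ∘ τ) := fun i j hij => h1 (Fin.rev_lt_rev.2 hij)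
  obtain ⟨p, hp⟩ := exists_shift_eq h2
  refine ⟨p, τ.symm, ?_⟩
  rw [hp]
  funext i
  simp

/-- Alternating power series. -/
def IsAlt (f : MvPowerSeries (Fin m) ℤ) : Prop :=
  ∀ w : Equiv.Perm (Fin m), renameEquiv ℤ w f = (Equiv.Perm.sign w : ℤ) • f

/-- Symmetric power series. -/
def IsSym (f : MvPowerSeries (Fin m) ℤ) : Prop :=
  ∀ w : Equiv.Perm (Fin m), renameEquiv ℤ w f = f

theorem IsAlt.coeff_comp {f : MvPowerSeries (Fin m) ℤ} (hf : IsAlt f) (u : Fin m → ℕ)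
    (w : Equiv.Perm (Fin m)) :
    coeff (expo (u ∘ w)) f = (Equiv.Perm.sign w : ℤ) * coeff (expo u) f := by
  rw [← coeff_expo_renameEquiv, hf w, map_zsmul, smul_eq_mul]

theorem IsAlt.coeff_eq_zero {f : MvPowerSeries (Fin m) ℤ} (hf : IsAlt f) {u : Fin m → ℕ}
    (hu : ¬ Function.Injective u) : coeff (expo u) f = 0 := by
  simp only [Function.Injective, not_forall] at hu
  obtain ⟨i, j, h, hij⟩ := hu
  have := hf.coeff_comp u (Equiv.swap i j)
  rw [Equiv.Perm.sign_swap hij, show u ∘ Equiv.swap i j = u from funext fun k => ?_] at this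
  · simp at this
    omega
  · simp only [Function.comp_apply, Equiv.swap_apply_def]
    split_ifs with h1 h2
    · rw [h1, h]
    · rw [h2, h]
    · rfl

theorem IsAlt.coeff_eq_zero_of_shift {f : MvPowerSeries (Fin m) ℤ} (hf : IsAlt f) (u : Fin m → ℕ)
    (h : ∀ (p : Part m) (σ : Equiv.Perm (Fin m)), u = shift p.1 ∘ σ →
      coeff (expo (shift p.1)) f = 0) : coeff (expo u) f = 0 := by
  by_cases hu : Function.Injective u
  · obtain ⟨p, σ, rfl⟩ := exists_shift_comp_eq hu
    rw [hf.coeff_comp, h p σ rfl, mul_zero]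
  · exact hf.coeff_eq_zero hu

/-- Exponents with a repeated entry have coefficient 0, and all others are rearrangements of some p
+ δ. -/
theorem IsAlt.ext {f g : MvPowerSeries (Fin m) ℤ} (hf : IsAlt f) (hg : IsAlt g)
    (h : ∀ p : Part m, coeff (expo (shift p.1)) f = coeff (expo (shift p.1)) g) : f = g := by
  rw [← sub_eq_zero]
  ext u
  have hfg : IsAlt (f - g) := fun w => by rw [map_sub, hf w, hg w, smul_sub]
  have := hfg.coeff_eq_zero_of_shift u fun p _ _ => by rw [map_sub, h p, sub_self]
  rwa [expo_coe] at this

theorem IsAlt.mul {f g : MvPowerSeries (Fin m) ℤ} (hf : IsAlt f) (hg : IsSym g) :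
    IsAlt (f * g) := fun w => by rw [map_mul, hf w, hg w, smul_mul_assoc]

theorem IsAlt.isSym_of_mul {f g : MvPowerSeries (Fin m) ℤ} (hf : IsAlt f) (h0 : f ≠ 0)
    (h : IsAlt (f * g)) : IsSym g := fun w => by
  have := h w
  rw [map_mul, hf w, smul_mul_assoc] at this
  rcases Int.units_eq_one_or (Equiv.Perm.sign w) with h1 | h1 <;> rw [h1] at this
  · simpa [h0] using this
  · simpa [h0] using this

theorem IsAlt.sum {κ : Type*} (s : Finset κ) {f : κ → MvPowerSeries (Fin m) ℤ}
    (h : ∀ i ∈ s, IsAlt (f i)) : IsAlt (∑ i ∈ s, f i) := fun w => by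
  rw [map_sum, smul_sum]
  exact sum_congr rfl fun i hi => h i hi w

theorem IsAlt.sub {f g : MvPowerSeries (Fin m) ℤ} (hf : IsAlt f) (hg : IsAlt g) :
    IsAlt (f - g) := fun w => by rw [map_sub, hf w, hg w, smul_sub]

theorem IsAlt.smul {f : MvPowerSeries (Fin m) ℤ} (hf : IsAlt f) (c : ℤ) :
    IsAlt (c • f) := fun w => by rw [map_zsmul, hf w, smul_comm]

/-- Antisymmetrisation gives alternating power series. -/
theorem isAlt_sum_sign (f : MvPowerSeries (Fin m) ℤ) :
    IsAlt (∑ w : Equiv.Perm (Fin m), (Equiv.Perm.sign w : ℤ) • renameEquiv ℤ w f) := fun σ => by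
  rw [map_sum, smul_sum, ← Equiv.sum_comp (Equiv.mulLeft σ)
    (fun w => (Equiv.Perm.sign σ : ℤ) • (Equiv.Perm.sign w : ℤ) • renameEquiv ℤ w f)]
  refine sum_congr rfl fun w _ => ?_
  rw [map_zsmul, Equiv.coe_mulLeft, map_mul, smul_smul]
  congr 1
  · rw [Units.val_mul, ← mul_assoc, ← Units.val_mul, Int.units_mul_self, Units.val_one, one_mul]
  · simp [Equiv.Perm.coe_mul]

/-! ### Alternants -/

theorem alternant_eq_sum (p : Fin m → ℕ) :
    (alternant p : MvPowerSeries (Fin m) ℤ) =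
      ∑ w : Equiv.Perm (Fin m), (Equiv.Perm.sign w : ℤ) •
        renameEquiv ℤ w (monomial (expo (shift p)) 1) := by
  rw [alternant, Matrix.det_apply, ← MvPolynomial.coeToMvPowerSeries.ringHom_apply, map_sum]
  refine sum_congr rfl fun w _ => ?_
  rw [Units.smul_def, map_zsmul, map_prod, monomial_expo, map_prod]
  congr 1
  refine prod_congr rfl fun i _ => ?_
  simp [shift]

theorem isAlt_alternant (p : Fin m → ℕ) : IsAlt (alternant p : MvPowerSeries (Fin m) ℤ) := by
  rw [alternant_eq_sum]
  exact isAlt_sum_sign _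

theorem coeff_alternant (p : Fin m → ℕ) (v : Fin m → ℕ) :
    coeff (expo v) (alternant p : MvPowerSeries (Fin m) ℤ) =
      ∑ w : Equiv.Perm (Fin m), if v ∘ w = shift p then (Equiv.Perm.sign w : ℤ) else 0 := by
  classical
  rw [alternant_eq_sum, map_sum]
  refine sum_congr rfl fun w _ => ?_
  rw [map_zsmul, coeff_expo_renameEquiv, coeff_monomial]
  simp only [expo_injective.eq_iff]
  split_ifs <;> simp

theorem coeff_shift_alternant (p q : Part m) :
    coeff (expo (shift q.1)) (alternant p.1 : MvPowerSeries (Fin m) ℤ) =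
      if q = p then 1 else 0 := by
  rw [coeff_alternant, sum_eq_single 1]
  · have : (shift q.1 = shift p.1) ↔ q = p := by
      rw [shift_injective.eq_iff, Subtype.ext_iff]
    simp [this]
  · intro w _ hw
    rw [if_neg]
    intro h
    exact hw (perm_eq_one_of_strictAnti (strictAnti_shift q) (h ▸ strictAnti_shift p))
  · simp

/-- The zero partition. -/
def zeroPart (m : ℕ) : Part m := ⟨0, fun _ _ _ => le_rfl⟩

theorem alternant_zero_ne_zero : (alternant (0 : Fin m → ℕ) : MvPowerSeries (Fin m) ℤ) ≠ 0 := by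
  intro h
  have := coeff_shift_alternant (zeroPart m) (zeroPart m)
  rw [show (zeroPart m).1 = 0 from rfl, h] at this
  simp at this

theorem det_vandermonde_X :
    (Matrix.vandermonde fun i : Fin m => (MvPolynomial.X i : MvPolynomial (Fin m) ℤ)).det =
      (Equiv.Perm.sign (Fin.revPerm : Equiv.Perm (Fin m)) : ℤ) * alternant (0 : Fin m → ℕ) := by
  have h := Matrix.det_permute' (Fin.revPerm : Equiv.Perm (Fin m)) (Matrix.of fun i j : Fin m =>
    (MvPolynomial.X i : MvPolynomial (Fin m) ℤ) ^ ((0 : Fin m → ℕ) j + (Fin.rev j : ℕ)))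
  rw [alternant, ← h]
  congr 1
  ext1 i j
  simp only [Matrix.vandermonde_apply, Matrix.submatrix_apply, Matrix.of_apply, id,
    Fin.revPerm_apply, Fin.rev_rev, Pi.zero_apply, zero_add]

theorem vand_eq : vand m = (Equiv.Perm.sign (Fin.revPerm : Equiv.Perm (Fin m)) : ℤ) •
    (alternant (0 : Fin m → ℕ) : MvPowerSeries (Fin m) ℤ) := by
  have h := congrArg MvPolynomial.coeToMvPowerSeries.ringHom (det_vandermonde_X (m := m))
  rw [Matrix.det_vandermonde] at h
  simp only [map_prod, map_sub, map_mul, map_intCast,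
    MvPolynomial.coeToMvPowerSeries.ringHom_apply, MvPolynomial.coe_X] at h
  rw [vand, h, zsmul_eq_mul]

end Alternating
end StableKL

namespace StableKL

/-! ### Tiled partitions as exponents of the chain series -/

section Tiled

open MvPowerSeries Finset

variable {m : ℕ}

theorem Part.part_coe (p : Part m) (i : Fin m) : p.part i = p.1 i := by
  simp [Part.part]

theorem Part.part_of_le (p : Part m) {i : ℕ} (h : m ≤ i) : p.part i = 0 := by
  simp [Part.part, h]

theorem Part.part_antitone (p : Part m) : Antitone p.part := by
  intro i j hij
  unfold Part.part
  split_ifs with h1 h2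
  · exact p.2 hij
  · omega
  · exact Nat.zero_le _
  · exact le_rfl

/-- The rows of a partition, read from below, as partial sums of column multiplicities. -/
theorem sum_Iic_eq_iff (p : Part m) (s : ℕ) (c : Fin m → ℕ) :
    (∀ j : Fin m, ∑ k ∈ Iic j, s * c k = p.1 (Fin.rev j)) ↔
      ∀ k : Fin m, s * c k + p.part (m - k) = p.part (m - 1 - k) := by
  have hrev (j : Fin m) : p.1 (Fin.rev j) = p.part (m - 1 - j) := by
    rw [← p.part_coe, Fin.val_rev]; congr 1; omega
  have hIic (j : ℕ) (h : j + 1 < m) (f : Fin m → ℕ) :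
      ∑ k ∈ Iic (⟨j + 1, h⟩ : Fin m), f k =
        ∑ k ∈ Iic (⟨j, by omega⟩ : Fin m), f k + f ⟨j + 1, h⟩ := by
    rw [← Finset.Iio_insert, sum_insert (by simp), add_comm]
    congr 2
    ext k
    simp only [mem_Iio, mem_Iic, Fin.lt_def, Fin.le_def]
    omega
  have hzero (h : 0 < m) (f : Fin m → ℕ) : ∑ k ∈ Iic (⟨0, h⟩ : Fin m), f k = f ⟨0, h⟩ := by
    rw [show Iic (⟨0, h⟩ : Fin m) = {⟨0, h⟩} from ?_, sum_singleton]
    ext k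
    simp [Fin.le_def, Fin.ext_iff]
  simp only [hrev]
  constructor
  · rintro H ⟨k, hk⟩
    rcases k with _ | k
    · have := H ⟨0, hk⟩
      rw [hzero] at this
      -- For the lowest row the part below it has index m and is 0 by default.
      rw [this, p.part_of_le (i := m - ((⟨0, hk⟩ : Fin m) : ℕ)) (by simp), add_zero]
    · have h1 := H ⟨k + 1, hk⟩
      rw [hIic, H ⟨k, by omega⟩] at h1
      simp only at h1 ⊢
      rw [show m - (k + 1) = m - 1 - k by omega]
      omega
  · rintro H ⟨j, hj⟩
    induction j with
    | zero =>
      have := H ⟨0, hj⟩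
      rw [hzero, ← this]
      simp [p.part_of_le]
    | succ j ih =>
      have h1 := H ⟨j + 1, hj⟩
      rw [hIic, ih (by omega), ← h1]
      simp only
      rw [show m - (j + 1) = m - 1 - j by omega]
      omega

/-- Column k covers the positions from k on, so each multiplicity is read off from two consecutive
rows. -/
theorem mem_solutions_chain_iff (d : Diamond) (p : Part m) (c : Fin m → ℕ) :
    c ∈ solutions (chainIdx d m) (chainVec d) (expo fun j => p.1 (Fin.rev j)) ↔
      (∀ k ∉ chainIdx d m, c k = 0) ∧
        ∀ k : Fin m, chainMult d * c k + p.part (m - k) = p.part (m - 1 - k) := by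
  rw [← sum_Iic_eq_iff]
  refine and_congr Iff.rfl ?_
  rw [DFunLike.ext_iff]
  refine forall_congr' fun j => ?_
  rw [expo_apply, Finsupp.finsetSum_apply]
  refine Eq.congr ?_ rfl
  simp only [Finsupp.smul_apply, chainVec, expo_apply, smul_eq_mul, mul_ite, mul_zero]
  rw [← sum_filter]
  refine sum_congr (by ext; simp) fun k _ => mul_comm _ _

/-- The differences of consecutive rows determine the multiplicities, so there is one solution or
none. -/
theorem ncard_solutions_chain (d : Diamond) (p : Part m) [Decidable (∀ k : Fin m,
      chainMult d ∣ p.part (m - 1 - k) - p.part (m - k) ∧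
      (k ∉ chainIdx d m → p.part (m - 1 - k) = p.part (m - k)))] :
    (solutions (chainIdx d m) (chainVec d) (expo fun j => p.1 (Fin.rev j))).ncard =
      if ∀ k : Fin m, chainMult d ∣ p.part (m - 1 - k) - p.part (m - k) ∧
        (k ∉ chainIdx d m → p.part (m - 1 - k) = p.part (m - k)) then 1 else 0 := by
  have hle (k : Fin m) : p.part (m - k) ≤ p.part (m - 1 - k) := p.part_antitone (by omega)
  have hs := chainMult_pos d
  split_ifs with h
  · rw [Set.ncard_eq_one]
    choose c hc using fun k => (h k).1
    refine ⟨c, ?_⟩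
    ext c'
    rw [mem_solutions_chain_iff, Set.mem_singleton_iff]
    constructor
    · rintro ⟨-, h2⟩
      funext k
      have h3 := h2 k
      have h4 := hc k
      have h5 := hle k
      exact Nat.eq_of_mul_eq_mul_left hs (by omega)
    · rintro rfl
      refine ⟨fun k hk => ?_, fun k => ?_⟩
      · have h3 := (h k).2 hk
        have h4 := hc k
        rw [h3, Nat.sub_self] at h4
        simpa [hs.ne'] using h4.symm
      · have h4 := hc k
        have h5 := hle k
        omega
  · rw [show solutions _ _ _ = ∅ from ?_, Set.ncard_empty]
    rw [Set.eq_empty_iff_forall_notMem]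
    intro c hc
    rw [mem_solutions_chain_iff] at hc
    refine h fun k => ⟨⟨c k, ?_⟩, fun hk => ?_⟩
    · have := hc.2 k; omega
    · have := hc.2 k
      rw [hc.1 k hk] at this
      omega

theorem card_filter_lt (p : Part m) (j l : ℕ) (hl : l ≤ m) (h1 : ∀ i, i < l → j < p.part i)
    (h2 : p.part l ≤ j) : (univ.filter fun i => j < p.1 i).card = l := by
  have : (univ.filter fun i => j < p.1 i) =
      (univ.filter fun i : Fin m => (i : ℕ) < l) := by
    ext i
    simp only [mem_filter, mem_univ, true_and, ← p.part_coe]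
    refine ⟨fun h => ?_, fun h => h1 _ h⟩
    by_contra hi
    have := p.part_antitone (not_lt.1 hi)
    omega
  rw [this, Fin.card_filter_val_lt, min_eq_right hl]

/-- The columns of length m - k number `p.part (m - 1 - k) - p.part (m - k)`. All rows are even when
these differences are, since the part with index m is 0; all columns are even when the differences
vanish for odd m - k. -/
theorem mem_tiled_iff {d : Diamond} (hd : d ≠ .empty) (p : Part m) :
    p ∈ tiled d m ↔ ∀ k : Fin m, chainMult d ∣ p.part (m - 1 - k) - p.part (m - k) ∧
        (k ∉ chainIdx d m → p.part (m - 1 - k) = p.part (m - k)) := by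
  cases d with
  | empty => exact absurd rfl hd
  | cell => simp [tiled, chainMult, chainIdx]
  | row =>
    simp only [tiled, chainMult, chainIdx, mem_univ, not_true, false_imp_iff, and_true,
      Set.mem_ofPred_eq]
    constructor
    · intro h k
      have he (i : ℕ) : Even (p.part i) := by
        unfold Part.part
        split_ifs with hi
        · exact h _
        · simp
      exact Nat.dvd_sub (he _).two_dvd (he _).two_dvd
    · intro h
      have he (l : ℕ) (hl : l ≤ m) : Even (p.part (m - l)) := by
        induction l with
        | zero => simp [p.part_of_le]
        | succ l ih =>
          have h1 := h ⟨l, by omega⟩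
          have h2 := ih (by omega)
          have h3 : p.part (m - l) ≤ p.part (m - 1 - l) := p.part_antitone (by omega)
          simp only at h1
          rw [show m - (l + 1) = m - 1 - l by omega]
          rw [Nat.even_iff] at h2 ⊢
          omega
      intro i
      have := he (m - i) (by omega)
      rwa [show m - (m - (i : ℕ)) = i by omega, p.part_coe] at this
  | column =>
    simp only [tiled, chainMult, chainIdx, mem_filter, mem_univ, true_and, one_dvd,
      Set.mem_ofPred_eq]
    constructor
    · intro h k hk
      by_contra hne
      have hle : p.part (m - k) ≤ p.part (m - 1 - k) := p.part_antitone (by omega)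
      -- If the two parts differ, the column with index `p.part (m - k)` has the odd length m - k.
      have := card_filter_lt p (p.part (m - k)) (m - k) (by omega) (fun i hi => by
        have : p.part (m - 1 - k) ≤ p.part i := p.part_antitone (by omega)
        omega) le_rfl
      exact hk (this ▸ h _)
    · intro h j
      -- The least such l is the length of column j. Were it odd, the parts with indices l - 1 and l
      -- would agree, although j separates them.
      have hex : ∃ l, p.part l ≤ j := ⟨m, by simp [p.part_of_le]⟩
      classical
      have hl : Nat.find hex ≤ m := Nat.find_min' hex (by simp [p.part_of_le])
      have hc := card_filter_lt p j (Nat.find hex) hl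
        (fun i hi => not_le.1 (Nat.find_min hex hi)) (Nat.find_spec hex)
      rw [hc]
      by_contra hodd
      have hpos : 0 < Nat.find hex := by
        rw [Nat.pos_iff_ne_zero]; intro h0; simp [h0] at hodd
      have h1 := h ⟨m - Nat.find hex, by omega⟩ (by
        simpa [show m - (m - Nat.find hex) = Nat.find hex by omega] using hodd)
      simp only at h1
      have h2 := Nat.find_spec hex
      have h3 := not_le.1 (Nat.find_min hex (m := Nat.find hex - 1) (by omega))
      rw [show m - (m - Nat.find hex) = Nat.find hex by omega,
        show m - 1 - (m - Nat.find hex) = Nat.find hex - 1 by omega] at h1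
      omega

/-- A sum of columns, read from below, is weakly increasing, and the added exponent j ↦ j makes it
strictly so. -/
theorem strictMono_of_coeff_chainSeries_ne_zero {d : Diamond} {u : Fin m → ℕ}
    (h : coeff (expo u) (chainSeries d m) ≠ 0) : StrictMono u := by
  classical
  rw [chainSeries, coeff_monomial_mul] at h
  split_ifs at h with hle
  · rw [one_mul, coeff_countOn] at h
    have hne : (solutions (chainIdx d m) (chainVec d)
        (expo u - expo fun j => (j : ℕ))).Nonempty := by
      rw [Set.nonempty_iff_ne_empty]
      intro h0
      simp [h0] at h
    obtain ⟨c, -, hc⟩ := hne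
    have hmono : Monotone fun j => u j - (j : ℕ) := by
      intro i j hij
      have hi := DFunLike.congr_fun hc i
      have hj := DFunLike.congr_fun hc j
      simp only [Finsupp.finsetSum_apply, Finsupp.smul_apply, Finsupp.tsub_apply,
        expo_apply, smul_eq_mul, chainVec] at hi hj
      simp only [← hi, ← hj]
      refine sum_le_sum fun k _ => Nat.mul_le_mul_left _ ?_
      split_ifs with h1 h2
      · exact le_rfl
      · exact absurd (h1.trans hij) h2
      · exact Nat.zero_le _
      · exact le_rfl
    intro i j hij
    have h1 := hmono hij.le
    have h2 : (i : ℕ) ≤ u i := by simpa using hle i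
    have h3 : (j : ℕ) ≤ u j := by simpa using hle j
    have h4 := Fin.lt_def.1 hij
    simp only at h1
    omega
  · exact absurd rfl h

open Classical in
theorem coeff_chainSeries {d : Diamond} (hd : d ≠ .empty) (p : Part m) :
    coeff (expo (shift p.1 ∘ Fin.rev)) (chainSeries d m) = if p ∈ tiled d m then 1 else 0 := by
  have hu : expo (shift p.1 ∘ Fin.rev) =
      (expo fun j => (j : ℕ)) + expo fun j => p.1 (Fin.rev j) := by
    ext j
    simp [shift, add_comm]
  rw [hu, chainSeries, coeff_add_monomial_mul, one_mul, coeff_countOn, ncard_solutions_chain]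
  simp only [mem_tiled_iff hd]
  split_ifs <;> simp

open Classical in
/-- The Littlewood identities: the product over the rest roots is the sum of the Schur functions of
the tiled partitions. -/
theorem coeff_alternant_mul_restSeries (d : Diamond) (p : Part m) :
    coeff (expo (shift p.1))
      ((alternant (0 : Fin m → ℕ) : MvPowerSeries (Fin m) ℤ) * restSeries d m) =
      if p ∈ tiled d m then 1 else 0 := by
  by_cases hd : d = .empty
  · subst hd
    rw [restSeries_empty, mul_one]
    have := coeff_shift_alternant (zeroPart m) p
    rw [show (zeroPart m).1 = 0 from rfl] at this
    rw [this]
    refine if_congr ?_ rfl rfl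
    simp [tiled, zeroPart, Subtype.ext_iff, funext_iff]
  · have hsq : (Equiv.Perm.sign (Fin.revPerm : Equiv.Perm (Fin m)) : ℤ) *
        (Equiv.Perm.sign (Fin.revPerm : Equiv.Perm (Fin m)) : ℤ) = 1 := by
      rw [← Units.val_mul, Int.units_mul_self, Units.val_one]
    have h := congrArg (coeff (expo (shift p.1))) (sum_sign_chainSeries (m := m) hd)
    -- Since p + δ decreases and the exponents of the chain series increase, only the reversal
    -- contributes. Its sign cancels the one in `vand_eq`.
    rw [vand_eq, smul_mul_assoc, map_zsmul, map_sum, sum_eq_single Fin.revPerm] at h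
    · rw [map_zsmul, coeff_expo_renameEquiv] at h
      simp only [smul_eq_mul] at h
      have h2 : coeff (expo (shift p.1 ∘ Fin.revPerm)) (chainSeries d m) =
          if p ∈ tiled d m then 1 else 0 := coeff_chainSeries hd p
      rw [← h2]
      have h3 := congrArg ((Equiv.Perm.sign (Fin.revPerm : Equiv.Perm (Fin m)) : ℤ) * ·) h
      simp only [← mul_assoc, hsq, one_mul] at h3
      exact h3.symm
    · intro w _ hw
      rw [map_zsmul, coeff_expo_renameEquiv]
      by_contra hne
      have hmono := strictMono_of_coeff_chainSeries_ne_zero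
        (fun h0 => hne (by rw [h0, smul_zero]))
      have hanti : StrictAnti (shift p.1 ∘ (Fin.revPerm.trans w)) :=
        fun i j hij => hmono (Fin.rev_lt_rev.2 hij)
      have := perm_eq_one_of_strictAnti (strictAnti_shift p) hanti
      apply hw
      ext i
      have h5 := DFunLike.congr_fun this (Fin.rev i)
      simpa [Fin.ext_iff] using h5
    · simp

theorem isAlt_alternant_mul_restSeries (d : Diamond) :
    IsAlt ((alternant (0 : Fin m → ℕ) : MvPowerSeries (Fin m) ℤ) * restSeries d m) := by
  by_cases hd : d = .empty
  · subst hd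
    rw [restSeries_empty, mul_one]
    exact isAlt_alternant _
  · have h := isAlt_sum_sign (chainSeries d m)
    rw [sum_sign_chainSeries hd, vand_eq, smul_mul_assoc] at h
    have h2 := h.smul (Equiv.Perm.sign (Fin.revPerm : Equiv.Perm (Fin m)) : ℤ)
    rwa [smul_smul, ← Units.val_mul, Int.units_mul_self, Units.val_one, one_smul] at h2

/-- The product with a_δ is alternating, and a_δ can be cancelled because power series over ℤ form a
domain. -/
theorem isSym_restSeries (d : Diamond) : IsSym (restSeries d m) :=
  (isAlt_alternant 0).isSym_of_mul alternant_zero_ne_zero (isAlt_alternant_mul_restSeries d)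

end Tiled
end StableKL

namespace StableKL

/-! ### Littlewood-Richardson coefficients as coefficients -/

section LittlewoodRichardson

open Finset

variable {m : ℕ}

/-- The alternant of `0` divides every alternant: reduce the powers of the variables modulo
`∏ (t - x_j)`. -/
theorem exists_schurPoly (p : Fin m → ℕ) :
    ∃ s : MvPolynomial (Fin m) ℤ, alternant (0 : Fin m → ℕ) * s = alternant p := by
  let P : Polynomial (MvPolynomial (Fin m) ℤ) :=
    ∏ j, (Polynomial.X - Polynomial.C (MvPolynomial.X j))
  have hP : P.Monic := Polynomial.monic_prod_of_monic _ _ fun j _ => Polynomial.monic_X_sub_C _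
  have hdeg : P.natDegree = m := by
    rw [Polynomial.natDegree_prod_of_monic _ _ fun j _ => Polynomial.monic_X_sub_C _]
    simp
  have hroot (i : Fin m) : P.eval (MvPolynomial.X i) = 0 := by
    rw [Polynomial.eval_prod]
    exact prod_eq_zero (mem_univ i) (by simp)
  let r (k : ℕ) : Polynomial (MvPolynomial (Fin m) ℤ) := Polynomial.X ^ k %ₘ P
  have hr (k : ℕ) (i : Fin m) : (MvPolynomial.X i : MvPolynomial (Fin m) ℤ) ^ k =
      ∑ l : Fin m, MvPolynomial.X i ^ (l : ℕ) * (r k).coeff l := by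
    have h1 : (r k).eval (MvPolynomial.X i) = MvPolynomial.X i ^ k := by
      have := congrArg (Polynomial.eval (MvPolynomial.X i))
        (Polynomial.modByMonic_add_div (Polynomial.X ^ k) P)
      rw [Polynomial.eval_add, Polynomial.eval_mul, hroot, zero_mul, add_zero] at this
      simpa using this
    have h2 : (r k).natDegree < m := by
      have hne : P ≠ 1 := by
        intro h
        rw [h, Polynomial.natDegree_one] at hdeg
        have := i.2
        omega
      have := Polynomial.natDegree_modByMonic_lt (Polynomial.X ^ k) hP hne
      rwa [hdeg] at this
    rw [← h1, Polynomial.eval_eq_sum_range' h2, ← Fin.sum_univ_eq_sum_range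
      (fun l => (r k).coeff l * MvPolynomial.X i ^ l)]
    exact sum_congr rfl fun l _ => mul_comm _ _
  refine ⟨(Equiv.Perm.sign (Fin.revPerm : Equiv.Perm (Fin m)) : ℤ) *
    (Matrix.of fun l j : Fin m => (r (shift p j)).coeff l).det, ?_⟩
  -- Every power of `X i` is a combination of the powers below m with coefficients independent of i,
  -- so the Vandermonde matrix splits off.
  have hmul : (Matrix.of fun i j : Fin m =>
      (MvPolynomial.X i : MvPolynomial (Fin m) ℤ) ^ (p j + (Fin.rev j : ℕ))) =
      (Matrix.vandermonde fun i : Fin m => (MvPolynomial.X i : MvPolynomial (Fin m) ℤ)) *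
        Matrix.of fun l j : Fin m => (r (shift p j)).coeff l := by
    ext1 i j
    rw [Matrix.mul_apply]
    exact hr (shift p j) i
  rw [alternant.eq_1 p, hmul, Matrix.det_mul, det_vandermonde_X]
  ring

/-- The Schur polynomial, as a polynomial. -/
noncomputable def schurPoly (p : Fin m → ℕ) : MvPolynomial (Fin m) ℤ := (exists_schurPoly p).choose

theorem alternant_mul_schurPoly (p : Fin m → ℕ) :
    alternant (0 : Fin m → ℕ) * schurPoly p = alternant p := (exists_schurPoly p).choose_spec

theorem alternant_zero_ne_zero' : alternant (0 : Fin m → ℕ) ≠ 0 := fun h =>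
  alternant_zero_ne_zero (m := m) (by rw [h]; simp)

theorem schur_eq (p : Part m) : schur p = algebraMap _ _ (schurPoly p.1) := by
  have h0 : algebraMap (MvPolynomial (Fin m) ℤ) (FractionRing (MvPolynomial (Fin m) ℤ))
      (alternant (0 : Fin m → ℕ)) ≠ 0 := fun h => alternant_zero_ne_zero' (m := m)
    (IsFractionRing.injective (MvPolynomial (Fin m) ℤ) _ (h.trans (map_zero _).symm))
  rw [schur, div_eq_iff h0, ← map_mul, mul_comm, alternant_mul_schurPoly]

theorem isSym_schurPoly (p : Fin m → ℕ) : IsSym (schurPoly p : MvPowerSeries (Fin m) ℤ) :=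
  (isAlt_alternant 0).isSym_of_mul alternant_zero_ne_zero (by
    rw [← MvPolynomial.coe_mul, alternant_mul_schurPoly]
    exact isAlt_alternant p)

theorem expo_shift_injective : Function.Injective fun p : Part m => expo (shift p.1) :=
  fun _ _ h => Subtype.ext (shift_injective (expo_injective h))

theorem coe_finsuppSum (c : Part m →₀ ℤ) :
    ((c.sum fun p k => k • alternant p.1 : MvPolynomial (Fin m) ℤ) : MvPowerSeries (Fin m) ℤ) =
      ∑ p ∈ c.support, c p • (alternant p.1 : MvPowerSeries (Fin m) ℤ) := by
  rw [Finsupp.sum, ← MvPolynomial.coeToMvPowerSeries.ringHom_apply, map_sum]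
  simp only [map_zsmul, MvPolynomial.coeToMvPowerSeries.ringHom_apply]

theorem coeff_sum_alternant (c : Part m →₀ ℤ) (q : Part m) :
    MvPowerSeries.coeff (expo (shift q.1))
      (∑ p ∈ c.support, c p • (alternant p.1 : MvPowerSeries (Fin m) ℤ)) = c q := by
  rw [map_sum]
  simp only [map_zsmul, coeff_shift_alternant, smul_eq_mul, mul_ite, mul_one, mul_zero]
  simp +contextual

/-- An alternating polynomial is a combination of alternants. -/
theorem exists_eq_sum_alternant {f : MvPolynomial (Fin m) ℤ}
    (hf : IsAlt (f : MvPowerSeries (Fin m) ℤ)) :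
    ∃ c : Part m →₀ ℤ, f = c.sum fun p k => k • alternant p.1 := by
  let c : Part m →₀ ℤ := Finsupp.ofSupportFinite
    (fun p => MvPolynomial.coeff (expo (shift p.1)) f)
    (Set.Finite.subset (f.support.finite_toSet.preimage expo_shift_injective.injOn)
      fun p hp => by simpa [MvPolynomial.mem_support_iff] using hp)
  refine ⟨c, MvPolynomial.coe_injective (σ := Fin m) (R := ℤ) ?_⟩
  rw [coe_finsuppSum]
  refine hf.ext (IsAlt.sum _ fun p _ => (isAlt_alternant p.1).smul _) fun q => ?_
  rw [coeff_sum_alternant]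
  rfl

/-- Multiplication by a_δ turns an expansion in Schur polynomials into one in alternants, where the
coefficient of x^{ν+δ} picks out a_{ν+δ}. An expansion exists because a_λ s_γ is alternating, and
the value does not depend on the one chosen. -/
theorem lrCoeff_eq (lam gam nu : Part m) :
    lrCoeff lam gam nu = MvPowerSeries.coeff (expo (shift nu.1))
      ((alternant lam.1 : MvPowerSeries (Fin m) ℤ) * (schurPoly gam.1 : MvPowerSeries _ ℤ)) := by
  have hiff (c : Part m →₀ ℤ) : schur lam * schur gam = (c.sum fun p k => k • schur p) ↔
      alternant lam.1 * schurPoly gam.1 = c.sum fun p k => k • alternant p.1 := by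
    have hinj := IsFractionRing.injective (MvPolynomial (Fin m) ℤ)
      (FractionRing (MvPolynomial (Fin m) ℤ))
    simp only [schur_eq]
    have h1 : (c.sum fun p k => k • algebraMap (MvPolynomial (Fin m) ℤ)
        (FractionRing (MvPolynomial (Fin m) ℤ)) (schurPoly p.1)) =
        algebraMap _ _ (c.sum fun p k => k • schurPoly p.1) := by
      simp only [Finsupp.sum, map_sum, map_zsmul]
    have h2 : (c.sum fun p k => k • alternant p.1) =
        alternant (0 : Fin m → ℕ) * c.sum fun p k => k • schurPoly p.1 := by
      simp only [Finsupp.sum, mul_sum, mul_smul_comm, alternant_mul_schurPoly]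
    rw [h1, ← map_mul, hinj.eq_iff, h2, ← alternant_mul_schurPoly lam.1, mul_assoc,
      mul_right_inj' alternant_zero_ne_zero']
  have halt : IsAlt ((alternant lam.1 * schurPoly gam.1 : MvPolynomial (Fin m) ℤ) :
      MvPowerSeries (Fin m) ℤ) := by
    rw [MvPolynomial.coe_mul]
    exact (isAlt_alternant _).mul (isSym_schurPoly _)
  have hex : ∃ c : Part m →₀ ℤ, schur lam * schur gam = c.sum fun p k => k • schur p := by
    obtain ⟨c, hc⟩ := exists_eq_sum_alternant halt
    exact ⟨c, (hiff c).2 hc⟩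
  rw [lrCoeff, dif_pos hex]
  have hc := (hiff _).1 hex.choose_spec
  rw [← MvPolynomial.coe_mul, hc, coe_finsuppSum, coeff_sum_alternant]

/-! ### Comparison of series up to a given degree -/

theorem degree_expo (u : Fin m → ℕ) : (expo u).degree = ∑ i, u i := by
  rw [Finsupp.degree_eq_sum]; rfl

theorem sum_shift (p : Part m) : ∑ i, shift p.1 i = p.size + ∑ i : Fin m, (Fin.rev i : ℕ) := by
  simp only [shift, sum_add_distrib, Part.size]

theorem finite_size_le (N : ℕ) : {p : Part m | p.size ≤ N}.Finite := by
  have h : (Subtype.val '' {p : Part m | p.size ≤ N}).Finite := by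
    refine (Set.finite_Icc (0 : Fin m → ℕ) fun _ => N).subset ?_
    rintro _ ⟨p, hp, rfl⟩
    exact ⟨fun _ => Nat.zero_le _, fun i => (single_le_sum (f := p.1) (fun _ _ => Nat.zero_le _)
      (mem_univ i)).trans hp⟩
  exact h.of_finite_image Subtype.val_injective.injOn

theorem order_alternant_zero_le :
    (alternant (0 : Fin m → ℕ) : MvPowerSeries (Fin m) ℤ).order ≤
      (∑ i : Fin m, (Fin.rev i : ℕ) : ℕ) := by
  have h := coeff_shift_alternant (zeroPart m) (zeroPart m)
  rw [if_pos rfl] at h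
  have h2 := MvPowerSeries.order_le (f := (alternant (zeroPart m).1 : MvPowerSeries (Fin m) ℤ))
    (d := expo (shift (zeroPart m).1)) (by rw [h]; exact one_ne_zero)
  rw [degree_expo, sum_shift] at h2
  simpa [Part.size, zeroPart] using h2

/-- If `a_δ f` is alternating and has no terms `x^{p + δ}` with `|p| ≤ N`, then `f` has no terms of
degree at most `N`. -/
theorem coeff_eq_zero_of_alternant_mul {f : MvPowerSeries (Fin m) ℤ} {N : ℕ}
    (halt : IsAlt ((alternant (0 : Fin m → ℕ) : MvPowerSeries (Fin m) ℤ) * f))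
    (h : ∀ p : Part m, p.size ≤ N → MvPowerSeries.coeff (expo (shift p.1))
      ((alternant (0 : Fin m → ℕ) : MvPowerSeries (Fin m) ℤ) * f) = 0)
    {u : Fin m →₀ ℕ} (hu : u.degree ≤ N) : MvPowerSeries.coeff u f = 0 := by
  -- The product a_δ f has no terms up to degree |δ| + N. Orders add over a domain and a_δ has order
  -- at most |δ|, so the order of `f` exceeds N.
  have hord : ((∑ i : Fin m, (Fin.rev i : ℕ) + (N + 1) : ℕ) : ℕ∞) ≤
      ((alternant (0 : Fin m → ℕ) : MvPowerSeries (Fin m) ℤ) * f).order := by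
    refine MvPowerSeries.le_order fun v hv => ?_
    rw [← expo_coe v]
    refine halt.coeff_eq_zero_of_shift _ fun p σ hp => h p ?_
    rw [← expo_coe v, degree_expo, hp] at hv
    have : ∑ i, (shift p.1 ∘ σ) i = ∑ i, shift p.1 i := Equiv.sum_comp σ (shift p.1)
    rw [this, sum_shift] at hv
    have := ENat.natCast_lt_natCast.1 hv
    omega
  rw [MvPowerSeries.order_mul] at hord
  have h1 : ((∑ i : Fin m, (Fin.rev i : ℕ) : ℕ) : ℕ∞) + ((N + 1 : ℕ) : ℕ∞) ≤
      ((∑ i : Fin m, (Fin.rev i : ℕ) : ℕ) : ℕ∞) + f.order := by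
    refine le_trans (le_of_eq ?_) (hord.trans (add_le_add_left order_alternant_zero_le _))
    push_cast
    rfl
  have h2 := (ENat.add_le_add_iff_left (ENat.natCast_ne_top _)).1 h1
  refine MvPowerSeries.coeff_of_lt_order (lt_of_lt_of_le ?_ h2)
  exact_mod_cast Nat.lt_succ_of_le hu

theorem coeff_alternant_mul_eq_zero {f : MvPowerSeries (Fin m) ℤ} {v : Fin m →₀ ℕ} {N : ℕ}
    (hv : v.degree ≤ N) (hf : ∀ u : Fin m →₀ ℕ, u.degree ≤ N → MvPowerSeries.coeff u f = 0)
    (g : MvPowerSeries (Fin m) ℤ) : MvPowerSeries.coeff v (g * f) = 0 := by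
  classical
  rw [MvPowerSeries.coeff_mul]
  refine sum_eq_zero fun p hp => ?_
  rw [hf p.2, mul_zero]
  rw [HasAntidiagonal.mem_antidiagonal] at hp
  have : p.1.degree + p.2.degree = v.degree := by rw [← hp]; simp
  omega

open Classical in
/-- The sum of the Littlewood-Richardson coefficients over the tiled partitions. -/
theorem finsum_lrCoeff (d : Diamond) (lam nu : Part m) :
    ∑ᶠ gam ∈ tiled d m, lrCoeff lam gam nu = MvPowerSeries.coeff (expo (shift nu.1))
      ((alternant lam.1 : MvPowerSeries (Fin m) ℤ) * restSeries d m) := by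
  -- Only terms of degree at most N of the second factor can reach x^{ν+δ}, which reduces the
  -- infinite sum over γ to |γ| ≤ N.
  set N := (expo (shift nu.1)).degree with hN
  set G : Finset (Part m) := (finite_size_le N).toFinset.filter (· ∈ tiled d m) with hG
  have hmemG (p : Part m) : p ∈ G ↔ p.size ≤ N ∧ p ∈ tiled d m := by simp [hG]
  have h1 : ∑ᶠ gam ∈ tiled d m, lrCoeff lam gam nu = ∑ gam ∈ G, lrCoeff lam gam nu := by
    refine finsum_mem_eq_sum_of_inter_support_eq _ ?_
    ext p
    simp only [Set.mem_inter_iff, Function.mem_support, mem_coe, hmemG]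
    refine ⟨fun h => ⟨⟨?_, h.1⟩, h.2⟩, fun h => ⟨h.1.2, h.2⟩⟩
    by_contra hlt
    refine h.2 ?_
    rw [lrCoeff_eq]
    -- For |γ| > N the product a_δ s_γ is the alternant of γ, without terms x^{p+δ} for |p| ≤ N;
    -- hence s_γ has no terms of degree up to N.
    refine coeff_alternant_mul_eq_zero (N := N) le_rfl (fun u hu => ?_) _
    refine coeff_eq_zero_of_alternant_mul ?_ (fun q hq => ?_) hu
    · rw [← MvPolynomial.coe_mul, alternant_mul_schurPoly]
      exact isAlt_alternant _
    · rw [← MvPolynomial.coe_mul, alternant_mul_schurPoly, coeff_shift_alternant, if_neg]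
      rintro rfl
      exact hlt hq
  have hmul : (alternant (0 : Fin m → ℕ) : MvPowerSeries (Fin m) ℤ) *
      (restSeries d m - ∑ gam ∈ G, (schurPoly gam.1 : MvPowerSeries (Fin m) ℤ)) =
      (alternant (0 : Fin m → ℕ) : MvPowerSeries (Fin m) ℤ) * restSeries d m -
        ∑ gam ∈ G, (alternant gam.1 : MvPowerSeries (Fin m) ℤ) := by
    rw [mul_sub, mul_sum]
    congr 1
    exact sum_congr rfl fun p _ => by rw [← MvPolynomial.coe_mul, alternant_mul_schurPoly]
  -- By the Littlewood identities, R and the sum of the s_γ over tiled γ with |γ| ≤ N agree up to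
  -- degree N.
  have h2 := coeff_alternant_mul_eq_zero (N := N) (v := expo (shift nu.1))
    (f := restSeries d m - ∑ gam ∈ G, (schurPoly gam.1 : MvPowerSeries (Fin m) ℤ))
    le_rfl (fun u hu => by
    refine coeff_eq_zero_of_alternant_mul ?_ (fun q hq => ?_) hu
    · rw [hmul]
      exact (isAlt_alternant_mul_restSeries d).sub (IsAlt.sum _ fun p _ => isAlt_alternant _)
    · rw [hmul, map_sub, coeff_alternant_mul_restSeries, map_sum]
      simp only [coeff_shift_alternant, sum_ite_eq, hmemG, hq, true_and]
      simp) (alternant lam.1 : MvPowerSeries (Fin m) ℤ)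
  rw [mul_sub, map_sub, sub_eq_zero] at h2
  rw [h1, h2, mul_sum, map_sum]
  exact sum_congr rfl fun p _ => lrCoeff_eq _ _ _

end LittlewoodRichardson
end StableKL

namespace StableKL

/-! ### Kostant partition functions of families of vectors -/

section Kostant

open Finset

variable {ι κ V W : Type*} [Fintype ι] [Fintype κ] [AddCommGroup V] [Module ℚ V]
  [AddCommGroup W] [Module ℚ W]

/-- The `q`-Kostant partition function of a family of vectors. -/
noncomputable def kostantFam (r : ι → V) (L : ι → ℚ) (β : V) : QPoly :=
  ∑ᶠ k ∈ {k : ι → ℕ | ∑ i, (k i : ℚ) • r i = β}, qPow (∑ i, (k i : ℚ) * L i)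

theorem kostantCoeff_eq_kostantFam (g : ClassicalType) (n : ℕ) (L : (Fin n → ℚ) → ℚ)
    (β : Fin n → ℚ) : kostantCoeff g n L β =
      kostantFam (fun α : posRoots g n => (α : Fin n → ℚ)) (fun α => L α) β := rfl

theorem kostantFam_equiv (e : κ ≃ ι) (r : ι → V) (L : ι → ℚ) (β : V) :
    kostantFam (r ∘ e) (L ∘ e) β = kostantFam r L β := by
  unfold kostantFam
  refine finsum_mem_eq_of_bijOn (fun k => k ∘ e.symm) ⟨fun k hk => ?_, fun k _ l _ h => ?_,
    fun k hk => ⟨k ∘ e, ?_, ?_⟩⟩ fun k _ => ?_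
  · rw [Set.mem_ofPred_eq, ← Equiv.sum_comp e] at *
    simpa using hk
  · funext i
    simpa using congrFun h (e i)
  · rw [Set.mem_ofPred_eq, ← Equiv.sum_comp e] at *
    simpa using hk
  · funext i; simp
  · rw [← Equiv.sum_comp e]
    simp

theorem kostantFam_map {f : V →ₗ[ℚ] W} (hf : Function.Injective f) (r : ι → V) (L : ι → ℚ)
    (β : V) : kostantFam (f ∘ r) L (f β) = kostantFam r L β := by
  unfold kostantFam
  congr! 4 with k
  simp only [Function.comp_apply, ← map_smul, ← map_sum, hf.eq_iff]

theorem kostantFam_eq_zero {r : ι → V} {L : ι → ℚ} {β : V}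
    (h : ∀ k : ι → ℕ, ∑ i, (k i : ℚ) • r i ≠ β) : kostantFam r L β = 0 := by
  unfold kostantFam
  rw [show {k : ι → ℕ | ∑ i, (k i : ℚ) • r i = β} = ∅ from
    Set.eq_empty_of_forall_notMem fun k hk => h k hk, finsum_mem_empty]

/-- Used with the first coordinate to lower the rank, and with the coordinate sum to discard sign
changes. -/
theorem kostantFam_eq_zero_of_neg {r : ι → V} {L : ι → ℚ} {β : V} (f : V →ₗ[ℚ] ℚ)
    (hf : ∀ i, 0 ≤ f (r i)) (hβ : f β < 0) : kostantFam r L β = 0 := by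
  refine kostantFam_eq_zero fun k hk => hβ.not_ge ?_
  rw [← hk, map_sum]
  refine sum_nonneg fun i _ => ?_
  rw [map_smul, smul_eq_mul]
  exact mul_nonneg (Nat.cast_nonneg _) (hf i)

theorem kostantFam_eq_zero_of_ne {r : ι → V} {L : ι → ℚ} {β : V} (f : V →ₗ[ℚ] ℚ)
    (hf : ∀ i, f (r i) = 0) (hβ : f β ≠ 0) : kostantFam r L β = 0 := by
  refine kostantFam_eq_zero fun k hk => hβ ?_
  rw [← hk, map_sum]
  refine sum_eq_zero fun i _ => ?_
  rw [map_smul, hf, smul_zero]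

theorem finite_kostant {r : ι → V} (f : V →ₗ[ℚ] ℚ) (hf : ∀ i, 1 ≤ f (r i)) (β : V) :
    {k : ι → ℕ | ∑ i, (k i : ℚ) • r i = β}.Finite := by
  classical
  refine (Set.finite_Icc (0 : ι → ℕ) fun _ => ⌊f β⌋₊).subset ?_
  rintro k rfl
  refine ⟨fun _ => Nat.zero_le _, fun i => Nat.le_floor ?_⟩
  rw [map_sum]
  have h (j : ι) : (k j : ℚ) ≤ f ((k j : ℚ) • r j) := by
    rw [map_smul, smul_eq_mul]
    exact le_mul_of_one_le_right (Nat.cast_nonneg _) (hf j)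
  exact (h i).trans (single_le_sum (f := fun j => f ((k j : ℚ) • r j))
    (fun j _ => (Nat.cast_nonneg _).trans (h j)) (mem_univ i))

theorem qPow_add (a b : ℚ) : qPow (a + b) = qPow a * qPow b := by
  simp [qPow, AddMonoidAlgebra.single_mul_single]

theorem qPow_zero : qPow 0 = 1 := rfl

/-- Splitting a family into two. -/
theorem kostantFam_sum {r : ι ⊕ κ → V} (L : ι ⊕ κ → ℚ) (f : V →ₗ[ℚ] ℚ) (hf : ∀ i, 1 ≤ f (r i))
    (β : V) : kostantFam r L β =
      ∑ᶠ k : κ → ℕ, qPow (∑ j, (k j : ℚ) * L (.inr j)) *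
        kostantFam (r ∘ .inl) (L ∘ .inl) (β - ∑ j, (k j : ℚ) • r (.inr j)) := by
  classical
  -- The condition becomes an indicator, so that the sum over pairs can be iterated; its support is
  -- finite because of `f`.
  let F : (κ → ℕ) × (ι → ℕ) → QPoly := fun p =>
    if ∑ i, (p.2 i : ℚ) • r (.inl i) + ∑ j, (p.1 j : ℚ) • r (.inr j) = β then
      qPow (∑ i, (p.2 i : ℚ) * L (.inl i) + ∑ j, (p.1 j : ℚ) * L (.inr j)) else 0
  let e : (ι ⊕ κ → ℕ) ≃ (κ → ℕ) × (ι → ℕ) :=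
    (Equiv.sumArrowEquivProdArrow ι κ ℕ).trans (Equiv.prodComm _ _)
  have he (k : ι ⊕ κ → ℕ) : F (e k) =
      if ∑ i, (k i : ℚ) • r i = β then qPow (∑ i, (k i : ℚ) * L i) else 0 := by
    simp only [Fintype.sum_sum_type]
    rfl
  have h1 : kostantFam r L β = ∑ᶠ p, F p := by
    rw [← finsum_comp_equiv e]
    unfold kostantFam
    refine finsum_congr fun k => ?_
    rw [he, finsum_eq_if]
    rfl
  rw [h1, finsum_curry]
  · refine finsum_congr fun k => ?_
    unfold kostantFam
    rw [mul_finsum]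
    refine finsum_congr fun l => ?_
    rw [finsum_eq_if, mul_ite, mul_zero]
    refine if_congr ?_ ?_ rfl
    · exact eq_sub_iff_add_eq.symm
    · rw [qPow_add, mul_comm]
      rfl
  · have hfin := (finite_kostant f hf β).image e
    refine hfin.subset fun p hp => ?_
    obtain ⟨k, rfl⟩ := e.surjective p
    refine ⟨k, ?_, rfl⟩
    rw [Function.mem_support, he] at hp
    by_contra hk
    exact hp (if_neg hk)

end Kostant

/-! ### Removing a leading coordinate -/

section Reduction

open Finset

/-- The height functional, which is at least `1` on every positive root. -/
def height (n : ℕ) : (Fin n → ℚ) →ₗ[ℚ] ℚ :=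
  ∑ i : Fin n, ((n : ℚ) - (i : ℕ)) • LinearMap.proj i

/-- The sum of the coordinates. -/
def coordSum (n : ℕ) : (Fin n → ℚ) →ₗ[ℚ] ℚ := ∑ i : Fin n, LinearMap.proj i

theorem coordSum_apply {n : ℕ} (v : Fin n → ℚ) : coordSum n v = ∑ i, v i := by
  simp [coordSum]

theorem height_eps {n : ℕ} (i : Fin n) : height n (eps i) = (n : ℚ) - (i : ℕ) := by
  simp [height, eps, Pi.single_apply]

theorem coordSum_eps {n : ℕ} (i : Fin n) : coordSum n (eps i) = 1 := by
  simp [coordSum, eps]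

theorem mem_diffRoots {n : ℕ} {α : Fin n → ℚ} :
    α ∈ diffRoots n ↔ ∃ i j : Fin n, i < j ∧ eps i - eps j = α := by
  simp [diffRoots]

theorem mem_sumRoots {n : ℕ} {α : Fin n → ℚ} :
    α ∈ sumRoots n ↔ ∃ i j : Fin n, i < j ∧ eps i + eps j = α := by
  simp [sumRoots]

theorem mem_posRoots_cases {g : ClassicalType} {n : ℕ} {α : Fin n → ℚ} (h : α ∈ posRoots g n) :
    α ∈ diffRoots n ∨ α ∈ sumRoots n ∨ ∃ i, α = eps i ∨ α = (2 : ℚ) • eps i := by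
  cases g <;> simp only [posRoots, mem_union, mem_image, mem_univ, true_and] at h
  · exact Or.inl h
  · rcases h with (h | h) | ⟨i, rfl⟩
    exacts [Or.inl h, Or.inr (Or.inl h), Or.inr (Or.inr ⟨i, Or.inl rfl⟩)]
  · rcases h with (h | h) | ⟨i, rfl⟩
    exacts [Or.inl h, Or.inr (Or.inl h), Or.inr (Or.inr ⟨i, Or.inr rfl⟩)]
  · rcases h with h | h
    exacts [Or.inl h, Or.inr (Or.inl h)]

theorem one_le_height {g : ClassicalType} {n : ℕ} {α : Fin n → ℚ} (h : α ∈ posRoots g n) :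
    1 ≤ height n α := by
  have hi (i : Fin n) : (1 : ℚ) ≤ n - (i : ℕ) := by
    have : (i : ℕ) + 1 ≤ n := i.2
    have : ((i : ℕ) : ℚ) + 1 ≤ n := by exact_mod_cast this
    linarith
  rcases mem_posRoots_cases h with h | h | ⟨i, rfl | rfl⟩
  · obtain ⟨i, j, hij, rfl⟩ := mem_diffRoots.1 h
    rw [map_sub, height_eps, height_eps]
    have : (i : ℕ) + 1 ≤ (j : ℕ) := hij
    have : ((i : ℕ) : ℚ) + 1 ≤ (j : ℕ) := by exact_mod_cast this
    linarith
  · obtain ⟨i, j, hij, rfl⟩ := mem_sumRoots.1 h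
    rw [map_add, height_eps, height_eps]
    linarith [hi i, hi j]
  · rw [height_eps]; exact hi i
  · rw [map_smul, height_eps, smul_eq_mul]; linarith [hi i]

theorem coordSum_nonneg {g : ClassicalType} {n : ℕ} {α : Fin n → ℚ} (h : α ∈ posRoots g n) :
    0 ≤ coordSum n α := by
  rcases mem_posRoots_cases h with h | h | ⟨i, rfl | rfl⟩
  · obtain ⟨i, j, hij, rfl⟩ := mem_diffRoots.1 h
    simp [coordSum_eps]
  · obtain ⟨i, j, hij, rfl⟩ := mem_sumRoots.1 h
    rw [map_add, coordSum_eps, coordSum_eps]; norm_num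
  · rw [coordSum_eps]; norm_num
  · rw [map_smul, coordSum_eps]; norm_num

/-- Prepending a zero coordinate. -/
def consZero (n : ℕ) : (Fin n → ℚ) →ₗ[ℚ] (Fin (n + 1) → ℚ) where
  toFun v := Fin.cons 0 v
  map_add' v w := by ext i; refine Fin.cases ?_ (fun i => ?_) i <;> simp
  map_smul' c v := by ext i; refine Fin.cases ?_ (fun i => ?_) i <;> simp

theorem consZero_injective (n : ℕ) : Function.Injective (consZero n) := fun v w h => funext fun i => by
  have := congrFun h i.succ
  simpa [consZero] using this

theorem consZero_eps {n : ℕ} (i : Fin n) : consZero n (eps i) = eps i.succ := by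
  ext j
  refine Fin.cases ?_ (fun j => ?_) j
  · simp [consZero, eps]
  · simp [consZero, eps, Pi.single_apply]

theorem consZero_mem_posRoots {g : ClassicalType} {n : ℕ} {α : Fin n → ℚ} (h : α ∈ posRoots g n) :
    consZero n α ∈ posRoots g (n + 1) := by
  have h1 (h : α ∈ diffRoots n) : consZero n α ∈ diffRoots (n + 1) := by
    obtain ⟨i, j, hij, rfl⟩ := mem_diffRoots.1 h
    exact mem_diffRoots.2 ⟨i.succ, j.succ, Fin.succ_lt_succ_iff.2 hij, by
      rw [map_sub, consZero_eps, consZero_eps]⟩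
  have h2 (h : α ∈ sumRoots n) : consZero n α ∈ sumRoots (n + 1) := by
    obtain ⟨i, j, hij, rfl⟩ := mem_sumRoots.1 h
    exact mem_sumRoots.2 ⟨i.succ, j.succ, Fin.succ_lt_succ_iff.2 hij, by
      rw [map_add, consZero_eps, consZero_eps]⟩
  cases g <;> simp only [posRoots, mem_union, mem_image, mem_univ, true_and] at h ⊢
  · exact h1 h
  · rcases h with (h | h) | ⟨i, rfl⟩
    exacts [Or.inl (Or.inl (h1 h)), Or.inl (Or.inr (h2 h)), Or.inr ⟨i.succ, (consZero_eps i).symm⟩]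
  · rcases h with (h | h) | ⟨i, rfl⟩
    exacts [Or.inl (Or.inl (h1 h)), Or.inl (Or.inr (h2 h)),
      Or.inr ⟨i.succ, by rw [map_smul, consZero_eps]⟩]
  · rcases h with h | h
    exacts [Or.inl (h1 h), Or.inr (h2 h)]

theorem posRoots_succ_cases {g : ClassicalType} {n : ℕ} {α : Fin (n + 1) → ℚ}
    (h : α ∈ posRoots g (n + 1)) : (∃ α' ∈ posRoots g n, consZero n α' = α) ∨ 0 < α 0 := by
  have h1 (h : α ∈ diffRoots (n + 1)) : (∃ α' ∈ diffRoots n, consZero n α' = α) ∨ 0 < α 0 := by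
    obtain ⟨i, j, hij, rfl⟩ := mem_diffRoots.1 h
    obtain ⟨j, rfl⟩ := Fin.exists_succ_eq.2 (Fin.ne_zero_of_lt hij)
    rcases Fin.eq_zero_or_eq_succ i with rfl | ⟨i, rfl⟩
    · exact Or.inr (by simp [eps])
    · exact Or.inl ⟨_, mem_diffRoots.2 ⟨i, j, Fin.succ_lt_succ_iff.1 hij, rfl⟩, by
        rw [map_sub, consZero_eps, consZero_eps]⟩
  have h2 (h : α ∈ sumRoots (n + 1)) : (∃ α' ∈ sumRoots n, consZero n α' = α) ∨ 0 < α 0 := by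
    obtain ⟨i, j, hij, rfl⟩ := mem_sumRoots.1 h
    obtain ⟨j, rfl⟩ := Fin.exists_succ_eq.2 (Fin.ne_zero_of_lt hij)
    rcases Fin.eq_zero_or_eq_succ i with rfl | ⟨i, rfl⟩
    · exact Or.inr (by simp [eps])
    · exact Or.inl ⟨_, mem_sumRoots.2 ⟨i, j, Fin.succ_lt_succ_iff.1 hij, rfl⟩, by
        rw [map_add, consZero_eps, consZero_eps]⟩
  cases g <;> simp only [posRoots, mem_union, mem_image, mem_univ, true_and] at h ⊢
  · exact h1 h
  · rcases h with (h | h) | ⟨i, rfl⟩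
    · exact (h1 h).imp_left fun ⟨a, ha, e⟩ => ⟨a, Or.inl (Or.inl ha), e⟩
    · exact (h2 h).imp_left fun ⟨a, ha, e⟩ => ⟨a, Or.inl (Or.inr ha), e⟩
    · rcases Fin.eq_zero_or_eq_succ i with rfl | ⟨i, rfl⟩
      · exact Or.inr (by simp [eps])
      · exact Or.inl ⟨_, Or.inr ⟨i, rfl⟩, consZero_eps i⟩
  · rcases h with (h | h) | ⟨i, rfl⟩
    · exact (h1 h).imp_left fun ⟨a, ha, e⟩ => ⟨a, Or.inl (Or.inl ha), e⟩
    · exact (h2 h).imp_left fun ⟨a, ha, e⟩ => ⟨a, Or.inl (Or.inr ha), e⟩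
    · rcases Fin.eq_zero_or_eq_succ i with rfl | ⟨i, rfl⟩
      · exact Or.inr (by simp [eps])
      · exact Or.inl ⟨_, Or.inr ⟨i, rfl⟩, by rw [map_smul, consZero_eps]⟩
  · rcases h with h | h
    · exact (h1 h).imp_left fun ⟨a, ha, e⟩ => ⟨a, Or.inl ha, e⟩
    · exact (h2 h).imp_left fun ⟨a, ha, e⟩ => ⟨a, Or.inr ha, e⟩

theorem zero_le_apply_zero {g : ClassicalType} {n : ℕ} {α : Fin (n + 1) → ℚ}
    (h : α ∈ posRoots g (n + 1)) : 0 ≤ α 0 := by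
  rcases posRoots_succ_cases h with ⟨α', -, rfl⟩ | h
  · exact le_rfl
  · exact h.le

theorem rootL_consZero (g : ClassicalType) (n : ℕ) (α : Fin n → ℚ) :
    rootL g (n + 1) (consZero n α) = rootL g n α := by
  simp [rootL, consZero, Fin.sum_univ_succ]

/-- Positive roots have nonnegative first coordinate, so a weight with first coordinate 0 involves
only those where it is 0, that is, the roots of rank n. -/
theorem kostantCoeff_consZero (g : ClassicalType) (n : ℕ) (v : Fin n → ℚ) :
    kostantCoeff g (n + 1) (rootL g (n + 1)) (consZero n v) = kostantCoeff g n (rootL g n) v := by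
  rw [kostantCoeff_eq_kostantFam, kostantCoeff_eq_kostantFam]
  let f : posRoots g n ⊕ {α : posRoots g (n + 1) // 0 < α.1 0} → posRoots g (n + 1) :=
    Sum.elim (fun α => ⟨consZero n α.1, consZero_mem_posRoots α.2⟩) (fun α => α.1)
  have hf : Function.Bijective f := by
    constructor
    · refine Function.Injective.sumElim (fun a b h => ?_) Subtype.val_injective fun a b h => ?_
      · exact Subtype.ext (consZero_injective n (congrArg Subtype.val h))
      · have := b.2
        rw [← h] at this
        exact lt_irrefl _ this
    · intro α
      rcases posRoots_succ_cases α.2 with ⟨α', h, h'⟩ | h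
      · exact ⟨Sum.inl ⟨α', h⟩, Subtype.ext h'⟩
      · exact ⟨Sum.inr ⟨α, h⟩, rfl⟩
  rw [← kostantFam_equiv (Equiv.ofBijective f hf),
    kostantFam_sum (r := (fun α : posRoots g (n + 1) => α.1) ∘ Equiv.ofBijective f hf) _
      (height (n + 1)) (fun i => one_le_height (f i).2), finsum_eq_single _ 0]
  · simp only [Pi.zero_apply, Nat.cast_zero, zero_mul, sum_const_zero, qPow_zero, zero_smul,
      sub_zero, one_mul]
    rw [← kostantFam_map (consZero_injective n)]
    congr 1
    funext α
    exact rootL_consZero g n α.1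
  · intro k hk
    rw [kostantFam_eq_zero_of_ne (LinearMap.proj 0) (fun i => rfl), mul_zero]
    obtain ⟨j, hj⟩ := Function.ne_iff.1 hk
    rw [map_sub, map_sum]
    have h1 (j) : 0 ≤ (LinearMap.proj 0 : (Fin (n + 1) → ℚ) →ₗ[ℚ] ℚ)
        ((k j : ℚ) • f (Sum.inr j)) := by
      rw [map_smul]
      exact mul_nonneg (Nat.cast_nonneg _) j.2.le
    have h2 : 0 < (LinearMap.proj 0 : (Fin (n + 1) → ℚ) →ₗ[ℚ] ℚ)
        ((k j : ℚ) • f (Sum.inr j)) := by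
      rw [map_smul]
      exact mul_pos (by exact_mod_cast Nat.pos_of_ne_zero hj) j.2
    have h3 := sum_pos' (fun j _ => h1 j) ⟨j, mem_univ j, h2⟩
    have h4 : (LinearMap.proj 0 : (Fin (n + 1) → ℚ) →ₗ[ℚ] ℚ) (consZero n v) = 0 := rfl
    rw [h4, zero_sub, neg_ne_zero]
    exact h3.ne'

/-- Summation over inverses turns the action into composition with σ. -/
theorem stableKL_eq_sum (g : ClassicalType) (n : ℕ) (L : (Fin n → ℚ) → ℚ) (a b : Fin n → ℚ) :
    stableKL g n L a b = ∑ σ : Equiv.Perm (Fin n), (Equiv.Perm.sign σ : ℤ) •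
      kostantCoeff g n L (fun i => (a + rho g n) (σ i) - (b + rho g n) i) := by
  rw [stableKL]
  refine sum_bij' (fun w _ => w.2.symm) (fun σ _ => ((fun _ => 1 : Fin n → ℤˣ), σ.symm))
    (fun _ _ => mem_univ _) (fun σ _ => by simp [symGroup]) (fun w hw => ?_) (fun σ _ => rfl)
    fun w hw => ?_
  · have hw' : ∀ i, w.1 i = 1 := by simpa [symGroup] using hw
    exact Prod.ext (funext fun i => (hw' i).symm) rfl
  · have hw' : ∀ i, w.1 i = 1 := by simpa [symGroup] using hw
    congr 1
    · simp [SignedPerm.sign, hw']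
    · congr 1
      funext i
      simp [SignedPerm.act, hw']

theorem rho_succ (g : ClassicalType) (n : ℕ) (j : Fin n) :
    rho g (n + 1) j.succ = rho g n j := by
  cases g <;> simp [rho] <;> ring

theorem rho_lt_rho_zero (g : ClassicalType) (n : ℕ) {i : Fin (n + 1)} (hi : i ≠ 0) :
    rho g (n + 1) i < rho g (n + 1) 0 := by
  have : 0 < (i : ℕ) := Nat.pos_of_ne_zero fun h => hi (Fin.ext h)
  have : (0 : ℚ) < (i : ℕ) := by exact_mod_cast this
  cases g <;> simp only [rho, Fin.val_zero, Nat.cast_zero] <;> linarith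

/-- A leading coordinate `M` that dominates the others can be removed. -/
theorem stableKL_cons (g : ClassicalType) (n : ℕ) {a b : Fin (n + 1) → ℚ} (hab : a 0 = b 0)
    (ha : ∀ i, a i ≤ a 0) :
    stableKL g (n + 1) (rootL g (n + 1)) a b =
      stableKL g n (rootL g n) (a ∘ Fin.succ) (b ∘ Fin.succ) := by
  rw [stableKL_eq_sum, stableKL_eq_sum, ← Equiv.Perm.decomposeFin.symm.sum_comp,
    Fintype.sum_prod_type, sum_eq_single 0]
  · refine sum_congr rfl fun e _ => ?_
    congr 1
    · rw [Equiv.Perm.decomposeFin.symm_sign]; simp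
    · refine Eq.trans ?_ (kostantCoeff_consZero g n _)
      congr 1
      funext i
      refine Fin.cases ?_ (fun i => ?_) i
      · simp [consZero, hab]
      · simp [consZero, rho_succ]
  -- If the image p of 0 is not 0, the first coordinate of the weight is a_p + ρ_p - a_0 - ρ_0 < 0.
  · intro p _ hp
    refine sum_eq_zero fun e _ => ?_
    rw [kostantCoeff_eq_kostantFam, kostantFam_eq_zero_of_neg
      (LinearMap.proj 0 : (Fin (n + 1) → ℚ) →ₗ[ℚ] ℚ) (fun α => zero_le_apply_zero α.2), smul_zero]
    simp only [LinearMap.proj_apply, Equiv.Perm.decomposeFin_symm_apply_zero, Pi.add_apply]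
    have := rho_lt_rho_zero g n hp
    have := ha p
    rw [← hab]
    linarith
  · simp

/-- The stable KL polynomial of complemented partitions does not depend on the rank. -/
theorem stableKL_hat (g : ClassicalType) {m n : ℕ} (hmn : m ≤ n) (lam mu : Part m) (M : ℕ) :
    stableKL g n (rootL g n) (lam.hat n M) (mu.hat n M) =
      stableKL g m (rootL g m) (lam.hat m M) (mu.hat m M) := by
  induction n, hmn using Nat.le_induction with
  | base => rfl
  | succ n hmn ih =>
    -- The leading coordinate comes from the part with index n ≥ m, which is 0.
    have h0 (p : Part m) : p.hat (n + 1) M 0 = M := by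
      simp [Part.hat, Part.part, hmn]
    have hs (p : Part m) : p.hat (n + 1) M ∘ Fin.succ = p.hat n M := by
      funext i
      simp [Part.hat]
    rw [stableKL_cons g n ((h0 lam).trans (h0 mu).symm) fun i => ?_, hs, hs, ih]
    rw [h0]
    simp [Part.hat]

end Reduction
end StableKL

namespace StableKL

/-! ### Splitting off the roots of type `A` -/

section Splitting

open Finset

variable {m : ℕ}

/-- An exponent as a weight. -/
def castVec (b : Fin m →₀ ℕ) : Fin m → ℚ := fun i => (b i : ℚ)

theorem castVec_add (a b : Fin m →₀ ℕ) : castVec (a + b) = castVec a + castVec b := by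
  ext i; simp [castVec]

theorem castVec_single (i : Fin m) : castVec (Finsupp.single i 1) = eps i := by
  ext j; simp [castVec, eps, Finsupp.single_apply, Pi.single_apply, eq_comm]

theorem castVec_injective : Function.Injective (castVec (m := m)) := fun a b h => by
  ext i; simpa [castVec] using congrFun h i

theorem coordSum_castVec (b : Fin m →₀ ℕ) : coordSum m (castVec b) = b.degree := by
  rw [coordSum_apply, Finsupp.degree_eq_sum]
  simp [castVec]

theorem castVec_sum {κ : Type*} [Fintype κ] (k : κ → ℕ) (α : κ → Fin m →₀ ℕ) :
    castVec (∑ j, k j • α j) = ∑ j, (k j : ℚ) • castVec (α j) := by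
  ext i
  simp [castVec]

theorem restVec_cell_eq (p : Fin m × Fin m) : restVec .cell p =
    if p.1 = p.2 then Finsupp.single p.1 1 else Finsupp.single p.1 1 + Finsupp.single p.2 1 := rfl

theorem le_of_mem_restPairs {d : Diamond} {p : Fin m × Fin m} (h : p ∈ restPairs d m) :
    p.1 ≤ p.2 := by
  cases d <;> simp [restPairs] at h
  exacts [h, h, h.le]

theorem restVec_injOn (d : Diamond) : Set.InjOn (restVec d) (restPairs d m : Set (Fin m × Fin m)) := by
  intro p hp q hq h
  have hp' := le_of_mem_restPairs hp
  have hq' := le_of_mem_restPairs hq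
  have key (h : Finsupp.single p.1 1 + Finsupp.single p.2 1 =
      (Finsupp.single q.1 1 + Finsupp.single q.2 1 : Fin m →₀ ℕ)) : p = q := by
    rw [Finsupp.single_add_single_eq_single_add_single one_ne_zero one_ne_zero] at h
    rcases h with ⟨h1, h2⟩ | ⟨-, h1, h2⟩ | ⟨h1, -⟩
    · exact Prod.ext h1 h2
    · rw [h1, h2] at hp'
      have := le_antisymm hp' hq'
      exact Prod.ext (by rw [h1, this]) (by rw [h2, this])
    · simp at h1
  cases d with
  | empty => simp [restPairs] at hp
  | row => exact key h
  | column => exact key h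
  | cell =>
    rw [restVec_cell_eq, restVec_cell_eq] at h
    have hdeg := congrArg Finsupp.degree h
    split_ifs at h hdeg with h1 h2 h2
    · rw [Finsupp.single_left_inj one_ne_zero] at h
      exact Prod.ext h (by rw [← h1, ← h2, h])
    · simp at hdeg
    · simp at hdeg
    · exact key h

theorem mem_posRoots_iff (d : Diamond) (α : Fin m → ℚ) : α ∈ posRoots d.type m ↔
    α ∈ diffRoots m ∨ ∃ p ∈ restPairs d m, castVec (restVec d p) = α := by
  cases d with
  | empty => simp [Diamond.type, posRoots, restPairs]
  | column =>
    simp only [Diamond.type, posRoots, mem_union, restPairs, restVec, mem_filter, mem_univ,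
      true_and, castVec_add, castVec_single, mem_sumRoots, Prod.exists]
  | row =>
    simp only [Diamond.type, posRoots, mem_union, restPairs, restVec, mem_filter, mem_univ,
      true_and, castVec_add, castVec_single, mem_sumRoots, Prod.exists, mem_image, or_assoc]
    refine or_congr_right ⟨?_, ?_⟩
    · rintro (⟨i, j, hij, h⟩ | ⟨i, h⟩)
      · exact ⟨i, j, hij.le, h⟩
      · exact ⟨i, i, le_rfl, by rw [← h, two_smul]⟩
    · rintro ⟨i, j, hij, h⟩
      rcases hij.lt_or_eq with hlt | rfl
      · exact Or.inl ⟨i, j, hlt, h⟩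
      · exact Or.inr ⟨i, by rw [← h, two_smul]⟩
  | cell =>
    simp only [Diamond.type, posRoots, mem_union, restPairs, restVec_cell_eq, mem_filter, mem_univ,
      true_and, mem_sumRoots, Prod.exists, mem_image, or_assoc]
    refine or_congr_right ⟨?_, ?_⟩
    · rintro (⟨i, j, hij, h⟩ | ⟨i, h⟩)
      · exact ⟨i, j, hij.le, by rw [if_neg hij.ne, castVec_add, castVec_single, castVec_single, h]⟩
      · exact ⟨i, i, le_rfl, by rw [if_pos rfl, castVec_single, h]⟩
    · rintro ⟨i, j, hij, h⟩
      rcases hij.lt_or_eq with hlt | rfl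
      · rw [if_neg hlt.ne, castVec_add, castVec_single, castVec_single] at h
        exact Or.inl ⟨i, j, hlt, h⟩
      · rw [if_pos rfl, castVec_single] at h
        exact Or.inr ⟨i, h⟩

theorem coordSum_diffRoots {α : Fin m → ℚ} (h : α ∈ diffRoots m) : coordSum m α = 0 := by
  obtain ⟨i, j, -, rfl⟩ := mem_diffRoots.1 h
  rw [map_sub, coordSum_eps, coordSum_eps, sub_self]

theorem sum_sq_eps_add {i j : Fin m} (hij : i ≠ j) (c : ℚ) :
    ∑ k, (eps i k + c * eps j k) ^ 2 = 1 + c ^ 2 := by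
  have h (k : Fin m) : (eps i k + c * eps j k) ^ 2 = eps i k + c ^ 2 * eps j k := by
    simp only [eps, Pi.single_apply]
    split_ifs with h1 h2
    · exact absurd (h1.symm.trans h2) hij
    · ring
    · ring
    · ring
  simp only [h, sum_add_distrib, ← mul_sum]
  simp [eps]

theorem rootL_diffRoots (g : ClassicalType) {α : Fin m → ℚ} (h : α ∈ diffRoots m) :
    rootL g m α = 1 := by
  obtain ⟨i, j, hij, rfl⟩ := mem_diffRoots.1 h
  have := sum_sq_eps_add hij.ne (-1)
  rw [rootL, if_neg]
  rintro ⟨-, h⟩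
  simp only [Pi.sub_apply] at h
  simp only [neg_one_mul, ← sub_eq_add_neg] at this
  rw [this] at h
  norm_num at h

/-- The reason for the choice of `rootL`: the value 1/2 on ε_i makes L half the coordinate sum on
every root outside type A. -/
theorem rootL_restVec {d : Diamond} {p : Fin m × Fin m} (h : p ∈ restPairs d m) :
    rootL d.type m (castVec (restVec d p)) = ((restVec d p).degree : ℚ) / 2 := by
  cases d with
  | empty => simp [restPairs] at h
  | row => simp [rootL, Diamond.type, restVec]
  | column => simp [rootL, Diamond.type, restVec]
  | cell =>
    rw [restVec_cell_eq]
    split_ifs with hp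
    · have h1 : ∑ i, eps p.1 i ^ 2 = 1 := by simp [eps, Pi.single_apply]
      rw [castVec_single, rootL, if_pos ⟨rfl, h1⟩]
      simp
    · rw [castVec_add, castVec_single, castVec_single, rootL, if_neg]
      · simp
      · rintro ⟨-, h⟩
        have := sum_sq_eps_add hp 1
        simp only [Pi.add_apply] at h
        simp only [one_mul] at this
        rw [this] at h
        norm_num at h

/-- The Kostant partition function of type `A`. -/
noncomputable def kostantA (m : ℕ) (β : Fin m → ℚ) : QPoly := kostantCoeff .A m (fun _ => 1) β

theorem kostantA_eq (β : Fin m → ℚ) :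
    kostantA m β = kostantFam (fun α : diffRoots m => (α : Fin m → ℚ)) (fun _ => 1) β := rfl

theorem kostantA_eq_zero {β : Fin m → ℚ} (h : coordSum m β ≠ 0) : kostantA m β = 0 := by
  rw [kostantA_eq]
  exact kostantFam_eq_zero_of_ne _ (fun α => coordSum_diffRoots α.2) h

/-- Negating and reversing a weight. -/
def negRev (m : ℕ) : (Fin m → ℚ) →ₗ[ℚ] (Fin m → ℚ) where
  toFun v := fun i => -v (Fin.rev i)
  map_add' v w := by ext i; simp; ring
  map_smul' c v := by ext i; simp

theorem negRev_negRev (v : Fin m → ℚ) : negRev m (negRev m v) = v := by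
  ext i; simp [negRev]

theorem negRev_injective : Function.Injective (negRev m) :=
  Function.LeftInverse.injective negRev_negRev

theorem negRev_eps (i : Fin m) : negRev m (eps i) = -eps (Fin.rev i) := by
  ext j
  simp [negRev, eps, Pi.single_apply, Fin.rev_eq_iff]

theorem negRev_mem_diffRoots {α : Fin m → ℚ} (h : α ∈ diffRoots m) : negRev m α ∈ diffRoots m := by
  obtain ⟨i, j, hij, rfl⟩ := mem_diffRoots.1 h
  refine mem_diffRoots.2 ⟨Fin.rev j, Fin.rev i, Fin.rev_lt_rev.2 hij, ?_⟩
  rw [map_sub, negRev_eps, negRev_eps]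
  abel

/-- Negation with reversal permutes the positive roots of type A. -/
theorem kostantA_negRev (β : Fin m → ℚ) : kostantA m (negRev m β) = kostantA m β := by
  rw [kostantA_eq, kostantA_eq]
  refine Eq.trans ?_ (kostantFam_map negRev_injective _ _ β)
  let e : diffRoots m ≃ diffRoots m :=
    { toFun := fun α => ⟨negRev m α.1, negRev_mem_diffRoots α.2⟩
      invFun := fun α => ⟨negRev m α.1, negRev_mem_diffRoots α.2⟩
      left_inv := fun α => Subtype.ext (negRev_negRev _)
      right_inv := fun α => Subtype.ext (negRev_negRev _) }
  exact (kostantFam_equiv e (fun α : diffRoots m => (α : Fin m → ℚ))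
    (fun _ => 1) _).symm

/-- A finite sum grouped along a map with finite fibres. -/
theorem finsum_comp_eq_finsum_ncard_smul {X Y M : Type*} [AddCommGroup M] (f : X → Y) (G : Y → M)
    (hG : G.support.Finite) (hf : ∀ y, (f ⁻¹' {y}).Finite) :
    ∑ᶠ x, G (f x) = ∑ᶠ y, ((f ⁻¹' {y}).ncard : ℤ) • G y := by
  classical
  have hfin : (f ⁻¹' G.support).Finite := hG.preimage' fun y _ => hf y
  rw [finsum_eq_sum_of_support_subset (s := hfin.toFinset) _ (by
      intro x hx; simpa using hx),
    finsum_eq_sum_of_support_subset (s := hG.toFinset) _ (by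
      intro y hy
      rw [Set.Finite.coe_toFinset, Function.mem_support]
      intro h0
      exact hy (by simp only [h0, smul_zero])),
    ← sum_fiberwise_of_maps_to (s := hfin.toFinset) (t := hG.toFinset) (g := f)
      (fun x hx => by simpa using hx)]
  refine sum_congr rfl fun y hy => ?_
  have h1 : ∀ x ∈ hfin.toFinset.filter (fun x => f x = y), G (f x) = G y := fun x hx => by
    rw [(mem_filter.1 hx).2]
  rw [sum_congr rfl h1, sum_const, ← natCast_zsmul]
  congr 2
  rw [Set.ncard_eq_toFinset_card _ (hf y)]
  congr 1
  ext x
  simp only [mem_filter, Set.Finite.mem_toFinset, Set.mem_preimage, Set.mem_singleton_iff,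
    Function.mem_support]
  refine ⟨fun h => h.2, fun h => ⟨?_, h⟩⟩
  rw [h]
  simpa using hy

/-- A nonzero value needs coordinate sum 0, which fixes the degree of `b`. -/
theorem finite_support_kostantA (β : Fin m → ℚ) :
    (Function.support fun b : Fin m →₀ ℕ => kostantA m (β - castVec b)).Finite := by
  refine (Finsupp.finite_of_degree_le (σ := Fin m) ⌊coordSum m β⌋₊).subset fun b hb => ?_
  have h : coordSum m (β - castVec b) = 0 := by
    by_contra h
    exact hb (kostantA_eq_zero h)
  rw [map_sub, coordSum_castVec, sub_eq_zero] at h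
  change b.degree ≤ _
  rw [h, Nat.floor_natCast]

/-- The Kostant partition function of `g_n` from that of type `A` and the series of the other
roots. -/
theorem kostantCoeff_eq_finsum (d : Diamond) (β : Fin m → ℚ) :
    kostantCoeff d.type m (rootL d.type m) β = qPow (coordSum m β / 2) *
      ∑ᶠ b : Fin m →₀ ℕ, MvPowerSeries.coeff b (restSeries d m) • kostantA m (β - castVec b) := by
  rw [kostantCoeff_eq_kostantFam]
  let f : diffRoots m ⊕ restPairs d m → posRoots d.type m :=
    Sum.elim (fun α => ⟨α.1, (mem_posRoots_iff d _).2 (Or.inl α.2)⟩)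
      (fun p => ⟨castVec (restVec d p.1), (mem_posRoots_iff d _).2 (Or.inr ⟨p.1, p.2, rfl⟩)⟩)
  have hf : Function.Bijective f := by
    constructor
    · refine Function.Injective.sumElim (fun a b h => ?_) (fun p q h => ?_) fun a p h => ?_
      · exact Subtype.ext (congrArg (fun α : posRoots d.type m => α.1) h)
      · exact Subtype.ext (restVec_injOn d p.2 q.2 (castVec_injective
          (congrArg (fun α : posRoots d.type m => α.1) h)))
      · have h1 := coordSum_diffRoots a.2
        have h2 : a.1 = castVec (restVec d p.1) :=
          congrArg (fun α : posRoots d.type m => α.1) h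
        rw [h2, coordSum_castVec, Nat.cast_eq_zero, Finsupp.degree_eq_zero_iff] at h1
        exact restVec_ne_zero d p.1 h1
    · intro α
      rcases (mem_posRoots_iff d _).1 α.2 with h | ⟨p, hp, h⟩
      · exact ⟨Sum.inl ⟨α, h⟩, rfl⟩
      · exact ⟨Sum.inr ⟨p, hp⟩, Subtype.ext h⟩
  rw [← kostantFam_equiv (Equiv.ofBijective f hf), kostantFam_sum
    (r := (fun α : posRoots d.type m => α.1) ∘ Equiv.ofBijective f hf) _ (height m)
    (fun i => one_le_height (f i).2)]
  have hsol (b : Fin m →₀ ℕ) : (fun k : restPairs d m → ℕ => ∑ p, k p • restVec d p.1) ⁻¹' {b} =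
      solutions univ (fun p : restPairs d m => restVec d p.1) b := by
    ext k
    simp [solutions]
  have hgroup := finsum_comp_eq_finsum_ncard_smul
    (fun k : restPairs d m → ℕ => ∑ p, k p • restVec d p.1)
    (fun b : Fin m →₀ ℕ => kostantA m (β - castVec b)) (finite_support_kostantA β)
    (fun b => by rw [hsol]; exact finite_solutions (fun _ _ => restVec_ne_zero _ _) b)
  simp only [hsol] at hgroup
  have hgroup' : ∑ᶠ k : restPairs d m → ℕ, kostantA m (β - castVec (∑ p, k p • restVec d p.1)) =
      ∑ᶠ b : Fin m →₀ ℕ, MvPowerSeries.coeff b (restSeries d m) • kostantA m (β - castVec b) :=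
    hgroup
  rw [← hgroup', mul_finsum]
  refine finsum_congr fun k => ?_
  have hA : kostantFam (((fun α : posRoots d.type m => α.1) ∘ Equiv.ofBijective f hf) ∘ Sum.inl)
      (((fun α : posRoots d.type m => rootL d.type m α.1) ∘ Equiv.ofBijective f hf) ∘ Sum.inl)
      (β - ∑ j, (k j : ℚ) •
        ((fun α : posRoots d.type m => α.1) ∘ Equiv.ofBijective f hf) (Sum.inr j)) =
      kostantA m (β - castVec (∑ p, k p • restVec d p.1)) := by
    rw [kostantA_eq, castVec_sum]
    have hL : (((fun α : posRoots d.type m => rootL d.type m α.1) ∘ Equiv.ofBijective f hf) ∘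
        Sum.inl) = fun _ => 1 := by
      funext α
      exact rootL_diffRoots _ α.2
    rw [hL]
    rfl
  rw [hA]
  -- If the remaining weight has coordinate sum 0, the chosen roots have total L equal to half the
  -- coordinate sum of β; otherwise both sides vanish.
  by_cases h0 : coordSum m (β - castVec (∑ p, k p • restVec d p.1)) = 0
  · congr 2
    rw [map_sub, sub_eq_zero] at h0
    rw [h0, castVec_sum, map_sum, sum_div]
    refine sum_congr rfl fun p _ => ?_
    rw [map_smul, coordSum_castVec, smul_eq_mul, mul_div_assoc, ← rootL_restVec p.2]
    rfl
  · rw [kostantA_eq_zero h0, mul_zero, mul_zero]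

end Splitting
end StableKL

namespace StableKL

/-! ### The stable KL polynomial as a sum of Kostka-Foulkes polynomials -/

section Assembly

open Finset

variable {m : ℕ}

theorem finsum_eq_finsum_comp {X Y M : Type*} [AddCommMonoid M] {g : X → Y}
    (hg : Function.Injective g) {f : Y → M} (h : ∀ y, y ∉ Set.range g → f y = 0) :
    ∑ᶠ y, f y = ∑ᶠ x, f (g x) := by
  classical
  rw [← finsum_mem_range hg]
  refine finsum_congr fun y => ?_
  by_cases hy : y ∈ Set.range g
  · rw [finsum_eq_dif, dif_pos hy]
  · rw [finsum_eq_dif, dif_neg hy, h y hy]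

/-- Pairing an alternating series with a function of the exponent. -/
theorem IsAlt.finsum_coeff_smul {f : MvPowerSeries (Fin m) ℤ} (hf : IsAlt f)
    {G : (Fin m →₀ ℕ) → QPoly} (hG : G.support.Finite) :
    ∑ᶠ u, MvPowerSeries.coeff u f • G u =
      ∑ᶠ nu : Part m, MvPowerSeries.coeff (expo (shift nu.1)) f •
        ∑ σ : Equiv.Perm (Fin m), (Equiv.Perm.sign σ : ℤ) • G (expo (shift nu.1 ∘ σ)) := by
  -- The map g parametrises the exponents with distinct entries; an alternating series has no
  -- others.
  let g : Part m × Equiv.Perm (Fin m) → (Fin m →₀ ℕ) := fun p => expo (shift p.1.1 ∘ p.2)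
  have hg : Function.Injective g := by
    rintro ⟨p, σ⟩ ⟨q, τ⟩ h
    have h1 : shift p.1 ∘ σ = shift q.1 ∘ τ := expo_injective h
    have h2 : shift p.1 ∘ (τ.symm.trans σ) = shift q.1 := by
      funext i
      have := congrFun h1 (τ.symm i)
      simpa using this
    have h3 : τ.symm.trans σ = 1 :=
      perm_eq_one_of_strictAnti (strictAnti_shift p) (h2 ▸ strictAnti_shift q)
    rw [h3] at h2
    refine Prod.ext (Subtype.ext (shift_injective h2)) ?_
    ext i
    have h4 := DFunLike.congr_fun h3 (τ i)
    simpa [Fin.ext_iff] using h4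
  rw [finsum_eq_finsum_comp hg, finsum_curry]
  · refine finsum_congr fun nu => ?_
    rw [finsum_eq_sum_of_fintype, smul_sum]
    refine sum_congr rfl fun σ _ => ?_
    rw [hf.coeff_comp, smul_smul, mul_comm]
  · refine (hG.preimage hg.injOn).subset fun p hp h0 => hp ?_
    simp only [h0, smul_zero]
  · intro u hu
    rw [← expo_coe u, hf.coeff_eq_zero fun hinj => hu ?_, zero_smul]
    obtain ⟨p, σ, h⟩ := exists_shift_comp_eq hinj
    exact ⟨(p, σ), by simp only [g, ← h, expo_coe]⟩

theorem alternant_eq_sum_monomial (p : Fin m → ℕ) :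
    (alternant p : MvPowerSeries (Fin m) ℤ) = ∑ σ : Equiv.Perm (Fin m),
      (Equiv.Perm.sign σ : ℤ) • MvPowerSeries.monomial (expo (shift p ∘ σ)) 1 := by
  classical
  rw [alternant_eq_sum, ← Equiv.sum_comp (Equiv.inv (Equiv.Perm (Fin m)))]
  refine sum_congr rfl fun σ _ => ?_
  rw [Equiv.inv_apply, Equiv.Perm.sign_inv]
  congr 1
  ext u
  rw [← expo_coe u, coeff_expo_renameEquiv, MvPowerSeries.coeff_monomial,
    MvPowerSeries.coeff_monomial]
  refine if_congr ?_ rfl rfl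
  rw [expo_injective.eq_iff, expo_injective.eq_iff]
  constructor
  · intro h
    funext i
    have := congrFun h (σ i)
    simpa using this
  · intro h
    funext i
    have := congrFun h (σ⁻¹ i)
    simpa using this

/-- Each monomial of the alternant merely translates the exponents of F. -/
theorem finsum_coeff_alternant_mul (p : Fin m → ℕ) (F : MvPowerSeries (Fin m) ℤ)
    {G : (Fin m →₀ ℕ) → QPoly} (hG : G.support.Finite) :
    ∑ᶠ u, MvPowerSeries.coeff u ((alternant p : MvPowerSeries (Fin m) ℤ) * F) • G u =
      ∑ σ : Equiv.Perm (Fin m), (Equiv.Perm.sign σ : ℤ) •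
        ∑ᶠ b, MvPowerSeries.coeff b F • G (expo (shift p ∘ σ) + b) := by
  classical
  have h1 (u : Fin m →₀ ℕ) :
      MvPowerSeries.coeff u ((alternant p : MvPowerSeries (Fin m) ℤ) * F) • G u =
      ∑ σ : Equiv.Perm (Fin m), (Equiv.Perm.sign σ : ℤ) •
        (MvPowerSeries.coeff u (MvPowerSeries.monomial (expo (shift p ∘ σ)) 1 * F) • G u) := by
    rw [alternant_eq_sum_monomial, sum_mul, map_sum, sum_smul]
    refine sum_congr rfl fun σ _ => ?_
    rw [smul_mul_assoc, map_zsmul, smul_smul, smul_eq_mul]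
  rw [finsum_congr h1, finsum_sum_comm]
  · refine sum_congr rfl fun σ _ => ?_
    rw [← smul_finsum]
    congr 1
    rw [finsum_eq_finsum_comp (add_right_injective (expo (shift p ∘ σ)))]
    · refine finsum_congr fun b => ?_
      rw [MvPowerSeries.coeff_add_monomial_mul, one_mul]
    · intro u hu
      rw [MvPowerSeries.coeff_monomial_mul, if_neg, zero_smul]
      intro hle
      exact hu ⟨u - expo (shift p ∘ σ), add_tsub_cancel_of_le hle⟩
  · intro σ _
    refine hG.subset fun u hu h0 => hu ?_
    simp only [h0, smul_zero]

/-- The Kostant partition function of type `A` relative to the weight `μ + ρ`. -/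
noncomputable def kostantRel (mu : Part m) (u : Fin m →₀ ℕ) : QPoly :=
  kostantA m (castVec u - castVec (expo (shift mu.1)))

theorem finite_support_kostantRel (mu : Part m) : (kostantRel mu).support.Finite := by
  refine (Finsupp.finite_of_degree_le (σ := Fin m) (expo (shift mu.1)).degree).subset fun u hu => ?_
  have h : coordSum m (castVec u - castVec (expo (shift mu.1))) = 0 := by
    by_contra h
    exact hu (kostantA_eq_zero h)
  rw [map_sub, coordSum_castVec, coordSum_castVec, sub_eq_zero, Nat.cast_inj] at h
  exact h.le

theorem cast_rev (i : Fin m) : ((Fin.rev i : ℕ) : ℚ) = (m : ℚ) - 1 - (i : ℕ) := by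
  rw [Fin.val_rev, Nat.cast_sub (by omega)]
  push_cast
  ring

/-- With the chosen normalisation, ρ in type A is δ. -/
theorem kostkaFoulkes_eq_sum (nu mu : Part m) :
    kostkaFoulkes nu mu = ∑ σ : Equiv.Perm (Fin m), (Equiv.Perm.sign σ : ℤ) •
      kostantRel mu (expo (shift nu.1 ∘ σ)) := by
  have h : kostkaFoulkes nu mu = stableKL .A m (fun _ => 1) (nu.weight m) (mu.weight m) := rfl
  rw [h, stableKL_eq_sum]
  refine sum_congr rfl fun σ _ => ?_
  rw [kostantRel, kostantA]
  congr 2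
  funext i
  simp only [Pi.add_apply, Pi.sub_apply, Part.weight, Part.part_coe, rho, castVec, expo_apply,
    Function.comp_apply, shift, Nat.cast_add, cast_rev]

/-- Up to a constant vector, complementing is the map `negRev`, and so is the passage from δ to ρ in
each type; the constants cancel in the difference. The weight then has coordinate sum |μ| - |λ| for
every permutation, so the power of q factors out. -/
theorem stableKL_hat_eq_finsum (d : Diamond) (lam mu : Part m) (M : ℕ) :
    stableKL d.type m (rootL d.type m) (lam.hat m M) (mu.hat m M) =
      qPow (((mu.size : ℚ) - (lam.size : ℚ)) / 2) *
        ∑ᶠ u, MvPowerSeries.coeff u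
          ((alternant lam.1 : MvPowerSeries (Fin m) ℤ) * restSeries d m) • kostantRel mu u := by
  rw [finsum_coeff_alternant_mul _ _ (finite_support_kostantRel mu), stableKL_eq_sum, mul_sum]
  -- Reversing coordinates conjugates σ by the reversal and keeps its sign.
  let c : Equiv.Perm (Fin m) ≃ Equiv.Perm (Fin m) := Equiv.permCongr Fin.revPerm
  refine Eq.trans (sum_congr rfl fun σ _ => ?_) (Equiv.sum_comp c _)
  have hc (i : Fin m) : c σ (Fin.rev i) = Fin.rev (σ i) := by simp [c]
  have hβ : (fun i => (lam.hat m M + rho d.type m) (σ i) - (mu.hat m M + rho d.type m) i) =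
      negRev m (castVec (expo (shift lam.1 ∘ c σ)) - castVec (expo (shift mu.1))) := by
    funext i
    simp only [negRev, LinearMap.coe_mk, AddHom.coe_mk, Pi.add_apply, Pi.sub_apply, castVec,
      expo_apply, Function.comp_apply, hc, shift, Fin.rev_rev, Part.hat, Part.part_coe,
      Nat.cast_add]
    cases d <;> simp only [Diamond.type, rho] <;> ring
  have hsum (v : Fin m → ℚ) : coordSum m (negRev m v) = -coordSum m v := by
    rw [coordSum_apply, coordSum_apply, ← Equiv.sum_comp Fin.revPerm v, ← sum_neg_distrib]
    rfl
  have hdeg : coordSum m (negRev m (castVec (expo (shift lam.1 ∘ c σ)) -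
      castVec (expo (shift mu.1)))) = (mu.size : ℚ) - lam.size := by
    have : ∑ i, (shift lam.1 ∘ c σ) i = ∑ i, shift lam.1 i := Equiv.sum_comp (c σ) (shift lam.1)
    rw [hsum, map_sub, coordSum_castVec, coordSum_castVec, degree_expo, degree_expo, this,
      sum_shift, sum_shift]
    push_cast
    ring
  have hsgn : Equiv.Perm.sign (c σ) = Equiv.Perm.sign σ := Equiv.Perm.sign_permCongr _ _
  rw [hβ, kostantCoeff_eq_finsum, hdeg, hsgn, mul_smul_comm]
  congr 2
  -- By symmetry of `restSeries` the exponents may be reversed; together with `kostantA_negRev` this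
  -- turns subtraction of b into addition.
  let r : (Fin m →₀ ℕ) ≃ (Fin m →₀ ℕ) :=
    { toFun := fun b => expo (b ∘ Fin.rev)
      invFun := fun b => expo (b ∘ Fin.rev)
      left_inv := fun b => by ext i; simp
      right_inv := fun b => by ext i; simp }
  rw [← finsum_comp_equiv r]
  refine finsum_congr fun b => ?_
  have hF : MvPowerSeries.coeff (r b) (restSeries d m) = MvPowerSeries.coeff b (restSeries d m) := by
    conv_rhs => rw [← isSym_restSeries d Fin.revPerm, ← expo_coe b, coeff_expo_renameEquiv]
    rfl
  rw [hF, kostantRel, ← kostantA_negRev]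
  congr 2
  rw [map_sub, negRev_negRev, castVec_add]
  have : negRev m (castVec (r b)) = -castVec b := by
    ext i
    simp [negRev, castVec, r]
  rw [this]
  abel

theorem stableKL_hat_eq_kostkaFoulkes (d : Diamond) (lam mu : Part m) (M : ℕ) :
    stableKL d.type m (rootL d.type m) (lam.hat m M) (mu.hat m M) =
      qPow (((mu.size : ℚ) - (lam.size : ℚ)) / 2) *
        ∑ᶠ nu : Part m, (∑ᶠ gam ∈ tiled d m, lrCoeff lam gam nu) • kostkaFoulkes nu mu := by
  rw [stableKL_hat_eq_finsum, ((isAlt_alternant lam.1).mul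
    (isSym_restSeries d)).finsum_coeff_smul (finite_support_kostantRel mu)]
  congr 1
  refine finsum_congr fun nu => ?_
  rw [finsum_lrCoeff, kostkaFoulkes_eq_sum]

/-- The substitution `q ↦ q⁻¹` as a ring homomorphism. -/
noncomputable def qInvHom : QPoly →+* QPoly :=
  AddMonoidAlgebra.mapDomainRingHom ℤ (negAddMonoidHom : ℚ →+ ℚ)

theorem qInvHom_apply (f : QPoly) : qInvHom f = qInv f := rfl

theorem qInv_qPow (r : ℚ) : qInv (qPow r) = qPow (-r) := by
  rw [qInv, qPow, AddMonoidAlgebra.mapDomain_single]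
  rfl

theorem qInv_injective : Function.Injective qInv :=
  AddMonoidAlgebra.mapDomain_injective neg_injective

theorem KPoly_eq (d : Diamond) (lam mu : Part m) (M : ℕ) :
    KPoly d lam mu = qPow ((mu.norm : ℚ) + (mu.size : ℚ) - (lam.size : ℚ)) *
      qInv (stableKL d.type m (rootL d.type m) (lam.hat m M) (mu.hat m M)) := by
  have hsum (c : Part m → ℤ) : qInvHom (∑ᶠ nu, c nu • kostkaFoulkes nu mu) =
      ∑ᶠ nu, c nu • qInv (kostkaFoulkes nu mu) := by
    -- Injectivity lets the map pass through the sum with no check of finite support.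
    refine ((qInvHom : QPoly →+ QPoly).map_finsum_of_injective qInv_injective _).trans ?_
    refine finsum_congr fun nu => ?_
    exact map_zsmul qInvHom _ _
  rw [stableKL_hat_eq_kostkaFoulkes, ← qInvHom_apply, map_mul, hsum, qInvHom_apply, qInv_qPow,
    ← mul_assoc, ← qPow_add, KPoly]
  simp only [cochargeKostka, ← mul_smul_comm]
  rw [← mul_finsum, ← mul_assoc, ← qPow_add]
  congr 2
  ring

end Assembly

/-! ### The stable range -/

section StableRange

open Finset

theorem sum_part {m n : ℕ} (hmn : m ≤ n) (p : Part m) : ∑ i : Fin n, p.part i = p.size := by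
  rw [Fin.sum_univ_eq_sum_range p.part n, Part.size]
  have : ∑ i, p.1 i = ∑ i ∈ range m, p.part i := by
    rw [← Fin.sum_univ_eq_sum_range p.part m]
    exact sum_congr rfl fun i _ => (p.part_coe i).symm
  rw [this]
  exact (sum_subset (range_mono hmn) fun i _ hi =>
    p.part_of_le (by simpa using hi)).symm

theorem coordSum_hat {m n : ℕ} (hmn : m ≤ n) (p : Part m) (M : ℕ) :
    coordSum n (p.hat n M) = n * M - p.size := by
  rw [coordSum_apply, ← sum_part hmn p, ← Equiv.sum_comp Fin.revPerm fun i : Fin n => p.part i]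
  simp [Part.hat]

theorem rho_nonneg (g : ClassicalType) {n : ℕ} (i : Fin n) : 0 ≤ rho g n i := by
  have h := i.2
  have h2 : ((i : ℕ) : ℚ) + 1 ≤ n := by exact_mod_cast h
  cases g <;> simp only [rho] <;> linarith

/-- Only the last coordinate of ρ in type D vanishes, and there the number of sign changes is even,
so some other index is negated as well. Positivity of ρ makes the final estimate strict. -/
theorem exists_neg_rho_pos (g : ClassicalType) {n : ℕ} {w : SignedPerm n}
    (hw : w ∈ weylGroup g n) (hs : w ∉ symGroup n) :
    ∃ i, w.1 i = -1 ∧ 0 < rho g n (w.2.symm i) := by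
  have hne : ∃ i, w.1 i = -1 := by
    by_contra h
    push Not at h
    exact hs (by
      simp only [symGroup, mem_filter, mem_univ, true_and]
      exact fun i => (Int.units_eq_one_or _).resolve_right (h i))
  obtain ⟨i, hi⟩ := hne
  have hb (j : Fin n) : ((j : ℕ) : ℚ) + 1 ≤ n := by exact_mod_cast j.2
  cases g with
  | A => exact absurd hw hs
  | B => exact ⟨i, hi, by simp only [rho]; linarith [hb (w.2.symm i)]⟩
  | C => exact ⟨i, hi, by simp only [rho]; linarith [hb (w.2.symm i)]⟩
  | D =>
    by_contra! h
    have hlast (j : Fin n) (hj : w.1 j = -1) : (w.2.symm j : ℕ) + 1 = n := by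
      have h1 := h j hj
      simp only [rho] at h1
      have h2 := hb (w.2.symm j)
      have h3 : ((w.2.symm j : ℕ) : ℚ) + 1 = n := by linarith
      exact_mod_cast h3
    have huniq (j : Fin n) (hj : j ≠ i) : w.1 j = 1 := by
      refine (Int.units_eq_one_or _).resolve_right fun h1 => hj ?_
      apply w.2.symm.injective
      ext
      have := hlast j h1
      have := hlast i hi
      omega
    have hprod : ∏ j, w.1 j = 1 := by simpa [weylGroup] using hw
    rw [prod_eq_single i (fun j _ hj => huniq j hj) (by simp), hi] at hprod
    exact absurd hprod (by decide)

/-- With a = λ̂ + ρ, a sign change at an entry a_j leaves the weight with coordinate sum at most |μ|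
- |λ| - 2 a_j. As a_j ≥ M - λ_1 + ρ_j, where ρ_j > 0 for a suitable j, this is negative and no sum
of positive roots can reach the weight. -/
theorem lusztigKL_hat_eq_stableKL (g : ClassicalType) {m n : ℕ} (hmn : m ≤ n) (lam mu : Part m)
    (M : ℕ) (hM : lam.part 0 ≤ M)
    (hM' : (lam.part 0 : ℚ) + ((mu.size : ℚ) - (lam.size : ℚ)) / 2 ≤ M) (L : (Fin n → ℚ) → ℚ) :
    lusztigKL g n L (lam.hat n M) (mu.hat n M) = stableKL g n L (lam.hat n M) (mu.hat n M) := by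
  have hsub : symGroup n ⊆ weylGroup g n := by
    intro w hw
    cases g with
    | A => exact hw
    | B => exact mem_univ _
    | C => exact mem_univ _
    | D =>
      have : ∀ i, w.1 i = 1 := by simpa [symGroup] using hw
      simp [weylGroup, this]
  refine (sum_subset hsub fun w hw hs => ?_).symm
  rw [kostantCoeff_eq_kostantFam, kostantFam_eq_zero_of_neg (coordSum n)
    (fun α => coordSum_nonneg α.2), smul_zero]
  obtain ⟨i, hi, hpos⟩ := exists_neg_rho_pos g hw hs
  set a := lam.hat n M + rho g n with ha
  have hage (j : Fin n) : (M : ℚ) - lam.part 0 + rho g n j ≤ a j := by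
    have : lam.part (Fin.rev j) ≤ lam.part 0 := lam.part_antitone (Nat.zero_le _)
    have : (lam.part (Fin.rev j) : ℚ) ≤ lam.part 0 := by exact_mod_cast this
    simp only [ha, Pi.add_apply, Part.hat]
    linarith
  have hMq : (lam.part 0 : ℚ) ≤ M := by exact_mod_cast hM
  have ha0 (j : Fin n) : 0 ≤ a j := by linarith [hage j, rho_nonneg g j]
  have hact (j : Fin n) : w.act a j ≤ a (w.2.symm j) := by
    have := ha0 (w.2.symm j)
    rcases Int.units_eq_one_or (w.1 j) with h | h <;> simp only [SignedPerm.act, h] <;>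
      push_cast <;> linarith
  have hacti : w.act a i = -a (w.2.symm i) := by
    simp [SignedPerm.act, hi]
  -- The entries of a are nonnegative, so further sign changes only lower the sum.
  have h1 : coordSum n (w.act a) ≤ coordSum n a - 2 * a (w.2.symm i) := by
    rw [coordSum_apply, coordSum_apply, ← Equiv.sum_comp w.2.symm a,
      ← add_sum_erase _ _ (mem_univ i), ← add_sum_erase _ (fun j => a (w.2.symm j)) (mem_univ i),
      hacti]
    have := sum_le_sum fun j (_ : j ∈ univ.erase i) => hact j
    linarith
  have h2 := hage (w.2.symm i)
  rw [map_sub, map_add]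
  have h3 : coordSum n a = n * M - lam.size + coordSum n (rho g n) := by
    rw [ha, map_add, coordSum_hat hmn]
  rw [coordSum_hat hmn]
  linarith

end StableRange

end StableKL

/-- Let `λ, μ` be partitions with at most `m ≤ n` parts and let `M` be an integer with
`M ≥ max(λ_1, μ_1)` (so that the complemented partitions are partitions) and
`M ≥ max(λ_1, μ_1) + (|μ| - |λ|)/2`. Then the `K`-polynomial is, up to a power of `q` and
`q ↦ q⁻¹`, both the stable KL polynomial and the Lusztig `q`-analogue of the complemented
partitions. -/
theorem theorem6 (d : StableKL.Diamond) (m n : ℕ) (hmn : m ≤ n) (lam mu : StableKL.Part m)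
    (M : ℕ) (hM : max (lam.part 0) (mu.part 0) ≤ M)
    (hM' : ((max (lam.part 0) (mu.part 0) : ℕ) : ℚ) + ((mu.size : ℚ) - (lam.size : ℚ)) / 2 ≤ M) :
    StableKL.KPoly d lam mu =
        StableKL.qPow ((mu.norm : ℚ) + (mu.size : ℚ) - (lam.size : ℚ)) *
          StableKL.qInv (StableKL.stableKL d.type n (StableKL.rootL d.type n)
            (lam.hat n M) (mu.hat n M)) ∧
      StableKL.KPoly d lam mu =
        StableKL.qPow ((mu.norm : ℚ) + (mu.size : ℚ) - (lam.size : ℚ)) *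
          StableKL.qInv (StableKL.lusztigKL d.type n (StableKL.rootL d.type n)
            (lam.hat n M) (mu.hat n M)) := by
  -- The identity holds in rank m; removing the leading coordinates M relates it to rank n.
  have h := (StableKL.KPoly_eq d lam mu M).trans (congrArg
    (fun f => StableKL.qPow ((mu.norm : ℚ) + (mu.size : ℚ) - (lam.size : ℚ)) * StableKL.qInv f)
    (StableKL.stableKL_hat d.type hmn lam mu M).symm)
  refine ⟨h, ?_⟩
  have hle : (lam.part 0 : ℚ) ≤ (max (lam.part 0) (mu.part 0) : ℕ) := by
    exact_mod_cast le_max_left _ _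
  rw [StableKL.lusztigKL_hat_eq_stableKL d.type hmn lam mu M ((le_max_left _ _).trans hM)
    (by linarith)]
  exact h
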